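/- Let $\Pi=(p_i)_{i\ge 1}$ be a sequence of pairwise distinct prime numbers. For a profinite group $H$ and a prime $p$, let $D_p(H)$ denote the kernel of the canonical map $H\to H_1(H,\mathbb{F}_p)$ to continuous homology, i.e. the closed subgroup topologically generated by all commutators and all $p$-th powers of elements of $H$. For a profinite group $G$ put $G^{\Pi(0)}=G$ and $G^{\Pi(n)}=D_{p_n}(G^{\Pi(n-1)})$ for $n\ge 1$; the group $G$ is called $\Pi$-graded if $\bigcap_{n} G^{\Pi(n)}=\{1\}$. Let $G$ be a $\Pi$-graded profinite group that is topologically finitely generated (i.e. contains a finitely generated dense subgroup). Then $G$ has polynomial normal subgroup growth: if $s_k^{\triangleleft}(G)$ denotes the number of open normal subgroups of $G$ of index at most $k$, then there are constants $C,b\in\mathbb{N}$ (depending on $G$) such that $s_k^{\triangleleft}(G)\le C\,k^{b}$ for all $k\ge 1$. -/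

import Mathlib

namespace GradedProfinite

variable {G : Type*} [Group G] [TopologicalSpace G]

/-- `G` is a topologically finitely generated topological group: it contains a finitely generated
dense subgroup. -/
def IsTopologicallyFG (G : Type*) [Group G] [TopologicalSpace G] : Prop :=
  ∃ Γ : Subgroup G, Γ.FG ∧ Dense (Γ : Set G)

/-- For a closed subgroup `H` of a profinite group `G`, the kernel `D_p(H)` of the canonical map
`H → H₁(H, 𝔽_p)` to continuous homology. Since `H₁(H, 𝔽_p)` is the largest profinite abelian
quotient of `H` of exponent dividing `p`, this kernel is the closed subgroup topologically generated
by the commutators and the `p`-th powers of elements of `H`. (As `H` is closed, the closure in `G`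
is the closure in `H`.) -/
def kerToH1 [IsTopologicalGroup G] (p : ℕ) (H : Subgroup G) : Subgroup G :=
  (⁅H, H⁆ ⊔ Subgroup.closure {x : G | ∃ h ∈ H, x = h ^ p}).topologicalClosure

/-- The series `G^{Π(0)} = G`, `G^{Π(n)} = D_{p_n}(G^{Π(n-1)})` attached to a sequence of primes
`Π = (p₁, p₂, …)`. The sequence is indexed from `0` here: `P n` is the prime `p_{n+1}`. -/
def gradedSeries (G : Type*) [Group G] [TopologicalSpace G] [IsTopologicalGroup G]
    (P : ℕ → ℕ) : ℕ → Subgroup G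
  | 0 => ⊤
  | n + 1 => kerToH1 (P n) (gradedSeries G P n)

/-- A profinite group `G` is `Π`-graded if the subgroups `G^{Π(n)}` intersect trivially. -/
def IsGraded (G : Type*) [Group G] [TopologicalSpace G] [IsTopologicalGroup G]
    (P : ℕ → ℕ) : Prop :=
  ⨅ n, gradedSeries G P n = ⊥

/-- The number `a_k` of open normal subgroups of index `k` (possibly `∞` a priori). -/
noncomputable def numOpenNormal (G : Type*) [Group G] [TopologicalSpace G] (k : ℕ) : ℕ∞ :=
  {N : Subgroup G | N.Normal ∧ IsOpen (N : Set G) ∧ N.index = k}.encard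

/-- The number `s_k = a_1 + ⋯ + a_k` of open normal subgroups of index at most `k`. -/
noncomputable def normalSubgroupGrowth (G : Type*) [Group G] [TopologicalSpace G] (k : ℕ) : ℕ∞ :=
  ∑ l ∈ Finset.Icc 1 k, numOpenNormal G l

/-- `s_k` is finite for all `k` and grows at most polynomially in `k`. -/
def HasPolynomialNormalSubgroupGrowth (G : Type*) [Group G] [TopologicalSpace G] : Prop :=
  ∃ C b : ℕ, ∀ k : ℕ, 1 ≤ k → normalSubgroupGrowth G k ≤ ((C * k ^ b : ℕ) : ℕ∞)

end GradedProfinite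

/-! Let `d` bound the number of topological generators. Since the primes are distinct, each finite
quotient `X` of `G` by an open normal subgroup is solvable with elementary abelian Sylow subgroups,
and it has rank at most `d`. It is enough to bound normal subgroups of such `X` polynomially, with
an exponent depending only on `d`.

By Gaschütz, a minimal normal subgroup of a quotient `X ⧸ N` has a complement. Hence a proper normal
subgroup `N` is `L ⊓ K` with `L` normal, `K` maximal and `[X:N] = [X:L][X:K]`. If there are at most
`n ^ (9d)` maximal subgroups of index `n`, induction gives at most `k ^ (9d+2)` normal subgroups of
index `k`.

A maximal subgroup of index `p ^ m` is the zero set of a crossed homomorphism into an irreducible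
module of dimension `m` over `ZMod p`. Once the module is fixed, `d` values determine it. The module
is induced from a primitive module of some `L ≤ X`. Abelian Sylow subgroups force a primitive module
to be a one-dimensional semilinear module over `GaloisField p n`, where `m = n [X:L]`. Since `L` has
rank at most `[X:L] d`, each `L` carries at most `p ^ (2md)` such actions.

It remains to count the subgroups `L`, whose index is at most `m`. The number of subgroups of index
`t` is at most `64 ^ (d(t-1))`, so those of index up to `m` number only a power of `p ^ m`. This
bound and the one on maximal subgroups are proved by one induction, which closes because `m < p ^
m`. -/

/-! ### Gaschütz's complement theorem -/

open scoped IsMulCommutative in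
/-- Gaschütz: an abelian normal subgroup is complemented if it is a direct factor of an abelian
subgroup of coprime index. -/
theorem Subgroup.exists_compl_of_retraction {G : Type*} [Group G] [Finite G]
    (S P : Subgroup G) [S.Normal] (hSP : S ≤ P) (hP : ∀ x ∈ P, ∀ y ∈ P, x * y = y * x)
    (hcop : (Nat.card S).Coprime P.index) (π : P →* S)
    (hπ : ∀ s (hs : s ∈ S), π ⟨s, hSP hs⟩ = ⟨s, hs⟩) :
    ∃ K : Subgroup G, K ⊓ S = ⊥ ∧ K ⊔ S = ⊤ := by
  classical
  have hcS : IsMulCommutative S :=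
    ⟨⟨fun a b => Subtype.ext (hP _ (hSP a.2) _ (hSP b.2))⟩⟩
  have := Fintype.ofFinite (G ⧸ P)
  let r : G ⧸ P → G := Quotient.out
  have hr : ∀ q : G ⧸ P, (r q : G ⧸ P) = q := fun q => QuotientGroup.out_eq' q
  have hmem : ∀ (x : G) (q : G ⧸ P), (r (x • q))⁻¹ * (x * r q) ∈ P := by
    intro x q
    rw [← QuotientGroup.eq, hr, ← smul_eq_mul, ← MulAction.Quotient.smul_coe, hr]
  let c : G → G ⧸ P → P := fun x q => ⟨_, hmem x q⟩
  have hc : ∀ x q, x * r q = r (x • q) * c x q := fun x q => by simp [c]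
  let κ : G →* MulAut S := MulAut.conjNormal
  have hκP : ∀ p : P, ∀ s : S, κ p s = s := by
    intro p s
    apply Subtype.ext
    rw [MulAut.conjNormal_apply, hP _ p.2 _ (hSP s.2)]
    simp
  -- Transfer of `π` from `P` to a crossed homomorphism on `G`. On `S` it is the power map with
  -- exponent `P.index`, bijective by coprimality, so its zero set is a complement. `P` being
  -- abelian, its elements act trivially on `S`.
  let δ : G → S := fun x => ∏ q : G ⧸ P, κ (r (x • q)) (π (c x q))
  have hδmul : ∀ x y, δ (x * y) = δ x * κ x (δ y) := by
    intro x y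
    have hcc : ∀ q, c (x * y) q = c x (y • q) * c y q := by
      intro q
      apply Subtype.ext
      have h1 := hc (x * y) q
      rw [mul_assoc, hc y q, ← mul_assoc, hc x, mul_smul, mul_assoc] at h1
      exact (mul_left_cancel h1).symm
    have h1 : δ x = ∏ q : G ⧸ P, κ (r ((x * y) • q)) (π (c x (y • q))) := by
      simp only [δ, mul_smul]
      exact (Equiv.prod_comp (MulAction.toPerm y)
        (fun q => κ (r (x • q)) (π (c x q)))).symm
    rw [h1]
    simp only [δ, map_prod]
    rw [← Finset.prod_mul_distrib]
    refine Finset.prod_congr rfl fun q _ => ?_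
    rw [hcc, map_mul, map_mul]
    congr 1
    rw [← MulAut.mul_apply, ← map_mul, hc x, map_mul, MulAut.mul_apply, hκP, mul_smul]
  have hδS : ∀ s : S, δ s = s ^ P.index := by
    intro s
    have : ∀ q : G ⧸ P, κ (r ((s : G) • q)) (π (c s q)) = s := by
      intro q
      have hq : (s : G) • q = q := by
        rw [← hr q, MulAction.Quotient.smul_coe, eq_comm, QuotientGroup.eq]
        apply hSP
        rw [smul_eq_mul, ← mul_assoc]
        simpa using (‹S.Normal›).conj_mem s s.2 (r q)⁻¹
      have hs' : (r q)⁻¹ * (s * r q) ∈ S := by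
        rw [← mul_assoc]
        simpa using (‹S.Normal›).conj_mem s s.2 (r q)⁻¹
      have : c s q = ⟨(r q)⁻¹ * (s * r q), hSP hs'⟩ := by
        apply Subtype.ext
        simp [c, hq]
      rw [this, hπ _ hs', hq]
      apply Subtype.ext
      rw [MulAut.conjNormal_apply]
      group
    simp only [δ, this]
    rw [Finset.prod_const, Finset.card_univ, ← Nat.card_eq_fintype_card, Subgroup.index]
  have hδ1 : δ 1 = 1 := by simpa using hδS 1
  let K : Subgroup G :=
    { carrier := {x | δ x = 1}
      one_mem' := hδ1
      mul_mem' := fun {a b} ha hb => by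
        simp only [Set.mem_ofPred_eq] at *
        rw [hδmul, ha, hb]; simp
      inv_mem' := fun {a} ha => by
        simp only [Set.mem_ofPred_eq] at *
        have := hδmul a⁻¹ a
        rw [inv_mul_cancel, hδ1, ha, map_one, mul_one] at this
        exact this.symm }
  refine ⟨K, ?_, ?_⟩
  · rw [eq_bot_iff]
    rintro x ⟨hx, hxS⟩
    have h1 : (⟨x, hxS⟩ : S) ^ P.index = 1 := (hδS ⟨x, hxS⟩).symm.trans hx
    have h2 : (powCoprime hcop) ⟨x, hxS⟩ = powCoprime hcop 1 := by
      simpa [powCoprime_apply] using h1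
    simpa using congrArg Subtype.val ((powCoprime hcop).injective h2)
  · rw [eq_top_iff]
    intro x _
    obtain ⟨s, hs⟩ := (powCoprime hcop).surjective (δ x)
    rw [powCoprime_apply] at hs
    have hk : (s⁻¹ : S) * x ∈ K := by
      change δ _ = 1
      rw [hδmul, hδS, hκP ⟨(s⁻¹ : S), hSP (s⁻¹).2⟩ (δ x), inv_pow, hs, inv_mul_cancel]
    have : x = s * ((s⁻¹ : S) * x) := by simp
    rw [this]
    exact mul_mem (Subgroup.mem_sup_right s.2) (Subgroup.mem_sup_left hk)

/-! ### Solvable groups with elementary abelian Sylow subgroups -/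

/-- A finite solvable group all of whose `p`-subgroups are elementary abelian. -/
structure IsElemAGroup (X : Type*) [Group X] : Prop where
  finite : Finite X
  solvable : Group.IsSolvable X
  comm : ∀ p : ℕ, p.Prime → ∀ P : Subgroup X, IsPGroup p P → ∀ x ∈ P, ∀ y ∈ P, x * y = y * x
  pow : ∀ p : ℕ, p.Prime → ∀ P : Subgroup X, IsPGroup p P → ∀ x ∈ P, x ^ p = 1

theorem IsElemAGroup.of_injective {X Y : Type*} [Group X] [Group Y] (hX : IsElemAGroup X)
    (f : Y →* X) (hf : Function.Injective f) : IsElemAGroup Y := by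
  have := hX.finite
  have := hX.solvable
  refine ⟨Finite.of_injective f hf, Group.isSolvable_of_isSolvable_injective hf, ?_, ?_⟩
  · intro p hp P hP x hx y hy
    apply hf
    simpa using hX.comm p hp (P.map f) (hP.map f) _ ⟨x, hx, rfl⟩ _ ⟨y, hy, rfl⟩
  · intro p hp P hP x hx
    apply hf
    simpa using hX.pow p hp (P.map f) (hP.map f) _ ⟨x, hx, rfl⟩

/-- A `p`-subgroup of a quotient of a finite group lifts to a `p`-subgroup. -/
theorem IsPGroup.exists_lift {X Y : Type*} [Group X] [Group Y] [Finite X]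
    {f : X →* Y} (hf : Function.Surjective f) {p : ℕ} (hp : p.Prime) {P : Subgroup Y}
    (hP : IsPGroup p P) : ∃ Q : Subgroup X, IsPGroup p Q ∧ P ≤ Q.map f := by
  have := Fact.mk hp
  have : Finite Y := Finite.of_surjective f hf
  obtain ⟨R, hR⟩ := hP.exists_le_sylow
  obtain ⟨Q, rfl⟩ := Sylow.mapSurjective_surjective hf p R
  exact ⟨Q, Q.2, hR⟩

theorem IsElemAGroup.of_surjective {X Y : Type*} [Group X] [Group Y] (hX : IsElemAGroup X)
    (f : X →* Y) (hf : Function.Surjective f) : IsElemAGroup Y := by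
  have := hX.finite
  have := hX.solvable
  refine ⟨Finite.of_surjective f hf, Group.isSolvable_of_surjective hf, ?_, ?_⟩
  · intro p hp P hP x hx y hy
    obtain ⟨Q, hQ, hPQ⟩ := hP.exists_lift hf hp
    obtain ⟨a, ha, rfl⟩ := hPQ hx
    obtain ⟨b, hb, rfl⟩ := hPQ hy
    rw [← map_mul, hX.comm p hp Q hQ a ha b hb, map_mul]
  · intro p hp P hP x hx
    obtain ⟨Q, hQ, hPQ⟩ := hP.exists_lift hf hp
    obtain ⟨a, ha, rfl⟩ := hPQ hx
    rw [← map_pow, hX.pow p hp Q hQ a ha, map_one]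

theorem IsElemAGroup.subgroup {X : Type*} [Group X] (hX : IsElemAGroup X) (H : Subgroup X) :
    IsElemAGroup H := hX.of_injective H.subtype H.subtype_injective

theorem IsElemAGroup.quotient {X : Type*} [Group X] (hX : IsElemAGroup X) (N : Subgroup X)
    [N.Normal] : IsElemAGroup (X ⧸ N) :=
  hX.of_surjective (QuotientGroup.mk' N) (QuotientGroup.mk'_surjective N)

/-! ### Minimal normal subgroups and their complements -/

/-- A nontrivial normal subgroup of a finite solvable group contains a minimal normal subgroup,
which is elementary abelian. -/
theorem Subgroup.exists_minimal_normal_le {X : Type*} [Group X] [Finite X] [Group.IsSolvable X]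
    (C : Subgroup X) [C.Normal] (hC : C ≠ ⊥) :
    ∃ S : Subgroup X, S.Normal ∧ S ≤ C ∧ S ≠ ⊥ ∧
      (∀ T : Subgroup X, T.Normal → T ≤ S → T = ⊥ ∨ T = S) ∧
      ∃ p : ℕ, p.Prime ∧ (∀ x ∈ S, ∀ y ∈ S, x * y = y * x) ∧ ∀ x ∈ S, x ^ p = 1 := by
  obtain ⟨S, hSmin⟩ := Set.Finite.exists_minimal
    (s := {S : Subgroup X | S.Normal ∧ S ≤ C ∧ S ≠ ⊥}) (Set.toFinite _) ⟨C, ‹_›, le_rfl, hC⟩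
  obtain ⟨hSn, hSC, hS⟩ := hSmin.prop
  have hmin : ∀ T : Subgroup X, T.Normal → T ≤ S → T = ⊥ ∨ T = S := by
    intro T hT hTS
    by_cases h : T = ⊥
    · exact Or.inl h
    · exact Or.inr (le_antisymm hTS (hSmin.le_of_le ⟨hT, hTS.trans hSC, h⟩ hTS))
  have hcomm : ⁅S, S⁆ = ⊥ := by
    have hlt := Group.IsSolvable.commutator_lt_of_ne_bot hS
    exact (hmin _ inferInstance hlt.le).resolve_right hlt.ne
  have hab : ∀ x ∈ S, ∀ y ∈ S, x * y = y * x := fun x hx y hy =>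
    ((Subgroup.commutator_eq_bot_iff_le_centralizer.1 hcomm) hx y hy).symm
  have hcard : Nat.card S ≠ 1 := by rwa [ne_eq, Subgroup.card_eq_one]
  obtain ⟨p, hp, hpd⟩ := Nat.exists_prime_and_dvd hcard
  have := Fact.mk hp
  refine ⟨S, hSn, hSC, hS, hmin, p, hp, hab, ?_⟩
  -- The `p`-torsion of `S` is normal in `X` and nontrivial by Cauchy, so by minimality it is all of
  -- `S`.
  let T : Subgroup X :=
    { carrier := {x | x ∈ S ∧ x ^ p = 1}
      one_mem' := ⟨one_mem _, one_pow _⟩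
      mul_mem' := fun {a b} ha hb => ⟨mul_mem ha.1 hb.1, by
        rw [(show Commute a b from hab a ha.1 b hb.1).mul_pow, ha.2, hb.2, one_mul]⟩
      inv_mem' := fun {a} ha => ⟨inv_mem ha.1, by rw [inv_pow, ha.2, inv_one]⟩ }
  have hT : T.Normal := ⟨fun a ha g => ⟨hSn.conj_mem a ha.1 g, by rw [conj_pow, ha.2]; simp⟩⟩
  have hTS : T ≤ S := fun x hx => hx.1
  have hT0 : T ≠ ⊥ := by
    obtain ⟨x, hx⟩ := exists_prime_orderOf_dvd_card' p hpd
    intro h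
    have hxT : (x : X) ∈ T := ⟨x.2, by
      rw [← hx, ← Subgroup.orderOf_coe, pow_orderOf_eq_one]⟩
    rw [h, Subgroup.mem_bot] at hxT
    have : x = 1 := Subtype.ext hxT
    rw [this, orderOf_one] at hx
    exact hp.one_lt.ne hx
  intro x hx
  rw [← (hmin T hT hTS).resolve_left hT0] at hx
  exact hx.2

/-- Subgroups of elementary abelian groups are retracts. -/
theorem Subgroup.exists_retraction_of_pow_eq_one {A : Type*} [CommGroup A] {p : ℕ}
    (hp : p.Prime) (hA : ∀ a : A, a ^ p = 1) (S : Subgroup A) :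
    ∃ π : A →* S, ∀ s : S, π s = s := by
  have := Fact.mk hp
  let : Module (ZMod p) (Additive A) := AddCommGroup.zmodModule (n := p) (fun x => hA x.toMul)
  let S' : Submodule (ZMod p) (Additive A) := AddSubgroup.toZModSubmodule p S.toAddSubgroup
  obtain ⟨f, hf⟩ := LinearMap.exists_leftInverse_of_injective S'.subtype S'.ker_subtype
  refine ⟨⟨⟨fun a => ⟨((f (Additive.ofMul a) : S') : Additive A).toMul, (f _).2⟩, ?_⟩, ?_⟩, ?_⟩
  · apply Subtype.ext
    simp
  · intro a b
    apply Subtype.ext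
    simp
  · intro s
    exact congrArg (fun z : S' => (⟨(z : Additive A).toMul, z.2⟩ : S))
      (LinearMap.congr_fun hf ⟨Additive.ofMul s, s.2⟩)

-- Gaschütz applies to a Sylow `p`-subgroup containing `S`: it is elementary abelian, so `S` is a
-- retract of it, and its index is prime to `p`.
open scoped IsMulCommutative in
theorem IsElemAGroup.exists_minimal_normal_compl {X : Type*} [Group X] [Nontrivial X]
    (hX : IsElemAGroup X) :
    ∃ S K : Subgroup X, S.Normal ∧ S ≠ ⊥ ∧
      (∀ T : Subgroup X, T.Normal → T ≤ S → T = ⊥ ∨ T = S) ∧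
      (∀ x ∈ S, ∀ y ∈ S, x * y = y * x) ∧ K ⊓ S = ⊥ ∧ K ⊔ S = ⊤ := by
  have := hX.finite
  have := hX.solvable
  obtain ⟨S, hSn, -, hS, hmin, p, hp, hab, hpow⟩ :=
    Subgroup.exists_minimal_normal_le (⊤ : Subgroup X) top_ne_bot
  have := Fact.mk hp
  have hSp : IsPGroup p S := fun x => ⟨1, by
    apply Subtype.ext
    simpa using hpow x x.2⟩
  obtain ⟨P, hSP⟩ := hSp.exists_le_sylow
  have hPc := hX.comm p hp P P.2
  have hPp := hX.pow p hp P P.2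
  have hcop : (Nat.card S).Coprime (P : Subgroup X).index := by
    obtain ⟨n, hn⟩ := IsPGroup.iff_card.1 hSp
    rw [hn]
    exact Nat.Coprime.pow_left _ ((Nat.Prime.coprime_iff_not_dvd hp).2 P.not_dvd_index)
  have hPcomm : IsMulCommutative (P : Subgroup X) :=
    ⟨⟨fun a b => Subtype.ext (hPc _ a.2 _ b.2)⟩⟩
  obtain ⟨π, hπ⟩ := Subgroup.exists_retraction_of_pow_eq_one hp
    (fun a : (P : Subgroup X) => Subtype.ext (by simpa using hPp _ a.2))
    (S.subgroupOf (P : Subgroup X))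
  obtain ⟨K, hK1, hK2⟩ := Subgroup.exists_compl_of_retraction S P hSP hPc hcop
    ((Subgroup.subgroupOfEquivOfLe hSP).toMonoidHom.comp π) (by
      intro s hs
      have h := hπ ⟨⟨s, hSP hs⟩, hs⟩
      apply Subtype.ext
      simpa using congrArg (fun z : S.subgroupOf P => (z : X)) h)
  exact ⟨S, K, hSn, hS, hmin, hab, hK1, hK2⟩

/-- For `L > K`, the group `L ⊓ S` is normalized by `K ≤ L` and centralized by the abelian `S`,
hence normal in `X`. Minimality of `S` leaves two cases: `L ⊓ S = ⊥` would force `L = K`, and `S ≤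
L` gives `L = ⊤`. -/
theorem Subgroup.isCoatom_of_compl {X : Type*} [Group X] {S K : Subgroup X} (hSn : S.Normal)
    (hS : S ≠ ⊥) (hmin : ∀ T : Subgroup X, T.Normal → T ≤ S → T = ⊥ ∨ T = S)
    (hab : ∀ x ∈ S, ∀ y ∈ S, x * y = y * x) (h1 : K ⊓ S = ⊥) (h2 : K ⊔ S = ⊤) : IsCoatom K := by
  refine ⟨?_, ?_⟩
  · rintro rfl
    exact hS (by simpa using h1)
  · intro L hL
    have hn : (L ⊓ S).Normal := by
      rw [← Subgroup.normalizer_eq_top_iff, eq_top_iff, ← h2, sup_le_iff]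
      constructor
      · intro k hk
        rw [Subgroup.mem_normalizer_iff]
        intro x
        have hk' := hL.le hk
        constructor
        · rintro ⟨hx1, hx2⟩
          exact ⟨L.mul_mem (L.mul_mem hk' hx1) (L.inv_mem hk'), hSn.conj_mem x hx2 k⟩
        · rintro ⟨hx1, hx2⟩
          have e : x = k⁻¹ * (k * x * k⁻¹) * k := by group
          rw [e]
          refine ⟨L.mul_mem (L.mul_mem (L.inv_mem hk') hx1) hk', ?_⟩
          simpa using hSn.conj_mem _ hx2 k⁻¹
      · intro s hs
        rw [Subgroup.mem_normalizer_iff]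
        intro x
        constructor
        · rintro ⟨hx1, hx2⟩
          rw [hab s hs x hx2]
          simpa using ⟨hx1, hx2⟩
        · rintro ⟨hx1, hx2⟩
          have hx : x ∈ S := by
            have := hSn.conj_mem _ hx2 s⁻¹
            have e : s⁻¹ * (s * x * s⁻¹) * s⁻¹⁻¹ = x := by group
            rwa [e] at this
          rw [hab s hs x hx] at hx1
          simpa [hx] using hx1
    rcases hmin _ hn inf_le_right with h | h
    · exfalso
      obtain ⟨x, hxL, hxK⟩ := SetLike.exists_of_lt hL
      have hx : x ∈ K ⊔ S := h2 ▸ Subgroup.mem_top x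
      rw [Subgroup.mem_sup_of_normal_right] at hx
      obtain ⟨k, hk, s, hs, rfl⟩ := hx
      have hsL : s ∈ L ⊓ S := ⟨by simpa using mul_mem (inv_mem (hL.le hk)) hxL, hs⟩
      rw [h, Subgroup.mem_bot] at hsL
      subst hsL
      exact hxK (by simpa using hk)
    · rw [eq_top_iff, ← h2, sup_le_iff]
      exact ⟨hL.le, inf_eq_right.1 h⟩

theorem Subgroup.index_eq_card_of_compl {X : Type*} [Group X] {S K : Subgroup X} (hSn : S.Normal)
    (h1 : K ⊓ S = ⊥) (h2 : K ⊔ S = ⊤) : K.index = Nat.card S := by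
  apply Subgroup.IsComplement'.index_eq_card
  apply Subgroup.isComplement'_of_disjoint_and_mul_eq_univ
  · rw [disjoint_iff, inf_comm, h1]
  · rw [← Subgroup.normal_mul, sup_comm, h2, Subgroup.coe_top]

/-- Every proper normal subgroup of an `IsElemAGroup` is the intersection of a larger normal
subgroup with a maximal subgroup, compatibly with indices. -/
theorem IsElemAGroup.normal_eq_inf_coatom {X : Type*} [Group X] (hX : IsElemAGroup X)
    (N : Subgroup X) [N.Normal] (hN : N ≠ ⊤) :
    ∃ L K : Subgroup X, L.Normal ∧ IsCoatom K ∧ N = L ⊓ K ∧ N.index = L.index * K.index := by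
  have hN' : Nontrivial (X ⧸ N) := QuotientGroup.nontrivial_iff.2 hN
  obtain ⟨S, K, hSn, hS, hmin, hab, h1, h2⟩ := (hX.quotient N).exists_minimal_normal_compl
  have hsurj := QuotientGroup.mk'_surjective N
  have hK := Subgroup.isCoatom_of_compl hSn hS hmin hab h1 h2
  refine ⟨S.comap (QuotientGroup.mk' N), K.comap (QuotientGroup.mk' N), inferInstance, ?_, ?_, ?_⟩
  · exact Subgroup.isCoatom_comap_of_surjective hsurj hK
  · rw [← Subgroup.comap_inf, inf_comm, h1, MonoidHom.comap_bot, QuotientGroup.ker_mk']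
  · rw [Subgroup.index_comap_of_surjective _ hsurj, Subgroup.index_comap_of_surjective _ hsurj,
      Subgroup.index_eq_card_of_compl hSn h1 h2, Subgroup.index_mul_card]
    rfl

/-! ### Maximal subgroups and crossed homomorphisms -/

/-- A linear action with exactly two invariant subspaces. -/
def ActsIrreducibly {p : ℕ} {X V : Type*} [Group X] [AddCommGroup V] [Module (ZMod p) V]
    (ρ : X →* Module.End (ZMod p) V) : Prop :=
  Nontrivial V ∧ ∀ U : Submodule (ZMod p) V, (∀ g, ∀ u ∈ U, ρ g u ∈ U) → U = ⊥ ∨ U = ⊤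

/-- `K` is the zero set of a crossed homomorphism `δ` with values in `ρ`. -/
structure IsPointStabilizer {p : ℕ} {X V : Type*} [Group X] [AddCommGroup V] [Module (ZMod p) V]
    (ρ : X →* Module.End (ZMod p) V) (δ : X → V) (K : Subgroup X) : Prop where
  map_mul : ∀ x y, δ (x * y) = δ x + ρ x (δ y)
  mem_iff : ∀ x, x ∈ K ↔ δ x = 0

theorem ActsIrreducibly.comp_surjective {p : ℕ} {X Y V : Type*} [Group X] [Group Y]
    [AddCommGroup V] [Module (ZMod p) V] {ρ : Y →* Module.End (ZMod p) V}
    (h : ActsIrreducibly ρ) {f : X →* Y} (hf : Function.Surjective f) :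
    ActsIrreducibly (ρ.comp f) := by
  refine ⟨h.1, fun U hU => h.2 U fun g u hu => ?_⟩
  obtain ⟨x, rfl⟩ := hf g
  exact hU x u hu

/-- Finite elementary abelian groups are coordinate spaces. -/
theorem CommGroup.exists_equiv_zmod_of_pow_eq_one {S : Type*} [CommGroup S] [Finite S] {p : ℕ}
    (hp : p.Prime) (hS : ∀ a : S, a ^ p = 1) :
    ∃ (m : ℕ) (e : (Fin m → ZMod p) ≃ S), ∀ a b, e (a + b) = e a * e b := by
  have := Fact.mk hp
  let : Module (ZMod p) (Additive S) := AddCommGroup.zmodModule (n := p) (fun x => hS x.toMul)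
  have : Finite (Additive S) := inferInstanceAs (Finite S)
  let b := Module.finBasis (ZMod p) (Additive S)
  exact ⟨_, b.equivFun.symm.toEquiv.trans Additive.toMul, fun x y =>
    congrArg Additive.toMul (map_add b.equivFun.symm x y)⟩

-- Here `ρ` is conjugation on `S`, read in the coordinates `e`, and `δ y` is the `S`-component of
-- `y` in the factorization `SK`. Invariant subspaces correspond to normal subgroups of `Y` inside
-- `S`, so minimality is irreducibility.
open scoped IsMulCommutative in
theorem Subgroup.exists_isPointStabilizer_of_compl {Y : Type*} [Group Y] {S K : Subgroup Y}
    (hSn : S.Normal) (hS : S ≠ ⊥)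
    (hmin : ∀ T : Subgroup Y, T.Normal → T ≤ S → T = ⊥ ∨ T = S)
    (hab : ∀ x ∈ S, ∀ y ∈ S, x * y = y * x) {p : ℕ}
    (h1 : K ⊓ S = ⊥) (h2 : K ⊔ S = ⊤) {A : Type*} [AddCommGroup A] [Module (ZMod p) A]
    (e : A ≃ S) (he : ∀ a b, e (a + b) = e a * e b) :
    ∃ (ρ : Y →* Module.End (ZMod p) A) (δ : Y → A),
      ActsIrreducibly ρ ∧ IsPointStabilizer ρ δ K := by
  have he' : ∀ s t, e.symm (s * t) = e.symm s + e.symm t := fun s t => by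
    rw [Equiv.symm_apply_eq, he]
    simp
  have he1 : e 0 = 1 := by simpa using he 0 0
  have he1' : e.symm 1 = 0 := by rw [← he1, Equiv.symm_apply_apply]
  let κ : Y →* MulAut S := MulAut.conjNormal
  let ρ : Y →* Module.End (ZMod p) A :=
    { toFun := fun y => AddMonoidHom.toZModLinearMap p
        (AddMonoidHom.mk' (fun a => e.symm (κ y (e a))) fun a b => by rw [he, map_mul, he'])
      map_one' := by
        ext x
        simp
      map_mul' := fun a b => by
        ext x
        simp }
  have hρ : ∀ y (s : S), ρ y (e.symm s) = e.symm (κ y s) := fun y s => by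
    simp [ρ]
  have hex : ∀ y : Y, ∃ s : S, (s : Y)⁻¹ * y ∈ K := by
    intro y
    have hy : y ∈ S ⊔ K := by
      rw [sup_comm, h2]
      exact Subgroup.mem_top y
    rw [Subgroup.mem_sup_of_normal_left] at hy
    obtain ⟨s, hs, k, hk, rfl⟩ := hy
    exact ⟨⟨s, hs⟩, by simpa using hk⟩
  choose d hd using hex
  have huniq : ∀ (y : Y) (s : S), (s : Y)⁻¹ * y ∈ K → d y = s := by
    intro y s hs
    have : (s⁻¹ * d y : S).1 ∈ K ⊓ S := by
      refine ⟨?_, (s⁻¹ * d y).2⟩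
      have := mul_mem hs (inv_mem (hd y))
      have e : (s : Y)⁻¹ * y * ((d y : Y)⁻¹ * y)⁻¹ = (s⁻¹ * d y : S) := by
        push_cast
        group
      rwa [e] at this
    rw [h1, Subgroup.mem_bot] at this
    have h3 : s⁻¹ * d y = 1 := Subtype.ext this
    rw [inv_mul_eq_one] at h3
    exact h3.symm
  refine ⟨ρ, fun y => e.symm (d y), ⟨?_, ?_⟩, ⟨?_, ?_⟩⟩
  · have : Nontrivial S := (Subgroup.nontrivial_iff_ne_bot S).2 hS
    exact e.nontrivial
  · intro U hU
    let T : Subgroup Y :=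
      { carrier := {x | ∃ u ∈ U, (e u : Y) = x}
        one_mem' := ⟨0, zero_mem _, by simp [he1]⟩
        mul_mem' := by
          rintro _ _ ⟨u, hu, rfl⟩ ⟨v, hv, rfl⟩
          exact ⟨u + v, add_mem hu hv, by simp [he]⟩
        inv_mem' := by
          rintro _ ⟨u, hu, rfl⟩
          refine ⟨-u, neg_mem hu, ?_⟩
          rw [eq_inv_iff_mul_eq_one, ← Subgroup.coe_mul, ← he, neg_add_cancel, he1,
            Subgroup.coe_one] }
    have hTS : T ≤ S := by
      rintro _ ⟨u, hu, rfl⟩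
      exact (e u).2
    have hTn : T.Normal := by
      refine ⟨?_⟩
      rintro _ ⟨u, hu, rfl⟩ g
      exact ⟨ρ g u, hU g _ hu, by simp [ρ, κ]⟩
    rcases hmin _ hTn hTS with h | h
    · left
      rw [eq_bot_iff]
      intro x hx
      have hx' : (e x : Y) ∈ T := ⟨x, hx, rfl⟩
      rw [h, Subgroup.mem_bot] at hx'
      have h3 : e x = e 0 := by
        rw [he1]
        exact Subtype.ext hx'
      exact e.injective h3
    · right
      rw [eq_top_iff]
      intro x _
      have hx' : (e x : Y) ∈ T := by
        rw [h]
        exact (e x).2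
      obtain ⟨u, hu, hux⟩ := hx'
      rwa [← e.injective (Subtype.ext hux)]
  · intro x y
    rw [hρ, ← he']
    congr 1
    apply huniq
    have hx := hd x
    set s := d x
    set t := d y
    have hy : (t : Y)⁻¹ * y ∈ K := hd y
    obtain ⟨k, hk⟩ : ∃ k, k = (s : Y)⁻¹ * x := ⟨_, rfl⟩
    rw [← hk] at hx
    have hxk : x = s * k := by rw [hk]; group
    have e2 : ((s * κ x t : S) : Y)⁻¹ * (x * y) = k * ((t : Y)⁻¹ * y) := by
      have e1 : κ x t = κ k t := by
        rw [hxk, map_mul, MulAut.mul_apply]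
        apply Subtype.ext
        rw [MulAut.conjNormal_apply, hab _ s.2 _ (κ k t).2]
        simp
      rw [e1, hxk]
      push_cast
      rw [MulAut.conjNormal_apply]
      group
    rw [e2]
    exact mul_mem hx hy
  · intro x
    constructor
    · intro hx
      rw [huniq x 1 (by simpa using hx), he1']
    · intro hx
      have h3 : d x = 1 := e.symm.injective (hx.trans he1'.symm)
      simpa [h3] using hd x

open scoped IsMulCommutative in
/-- A maximal subgroup of a finite solvable group is a point stabilizer for an affine action with
irreducible linear part. -/
theorem IsElemAGroup.exists_isPointStabilizer {X : Type*} [Group X] (hX : IsElemAGroup X)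
    {K : Subgroup X} (hK : IsCoatom K) :
    ∃ p m : ℕ, p.Prime ∧ K.index = p ^ m ∧
      ∃ (ρ : X →* Module.End (ZMod p) (Fin m → ZMod p)) (δ : X → (Fin m → ZMod p)),
        ActsIrreducibly ρ ∧ IsPointStabilizer ρ δ K := by
  have hsurj := QuotientGroup.mk'_surjective K.normalCore
  have hY := hX.quotient K.normalCore
  have := hY.finite
  have := hY.solvable
  have hle : K.normalCore ≤ K := K.normalCore_le
  set π := QuotientGroup.mk' K.normalCore with hπ
  have hne : K.normalCore ≠ ⊤ := fun h => hK.1 (top_le_iff.1 (h ▸ hle))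
  have : Nontrivial (X ⧸ K.normalCore) := QuotientGroup.nontrivial_iff.2 hne
  obtain ⟨S, hSn, -, hS, hmin, p, hp, hab, hpow⟩ :=
    Subgroup.exists_minimal_normal_le (⊤ : Subgroup (X ⧸ K.normalCore)) top_ne_bot
  have hcm : (K.map π).comap π = K := by
    rw [Subgroup.comap_map_eq, hπ, QuotientGroup.ker_mk', sup_eq_left.2 hle]
  have hmaxY : ∀ L : Subgroup (X ⧸ K.normalCore), K.map π ≤ L → L = K.map π ∨ L = ⊤ := by
    intro L hL
    have h1 : K ≤ L.comap π := Subgroup.map_le_iff_le_comap.1 hL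
    have hLL := Subgroup.map_comap_eq_self_of_surjective hsurj L
    rcases hK.le_iff.1 h1 with h | h
    · right
      rw [← hLL, h, Subgroup.map_top_of_surjective _ hsurj]
    · left
      rw [← hLL, h]
  -- Otherwise the preimage of `S` would be a normal subgroup inside `K`, hence inside the core,
  -- making `S` trivial. This is why the core is factored out.
  have hSK : ¬ S ≤ K.map π := by
    intro h
    apply hS
    have h3 : S.comap π ≤ K := (Subgroup.comap_mono h).trans hcm.le
    have h4 : S.comap π ≤ K.normalCore := Subgroup.normal_le_normalCore.2 h3
    rw [← Subgroup.map_comap_eq_self_of_surjective hsurj S, eq_bot_iff, Subgroup.map_le_iff_le_comap,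
      MonoidHom.comap_bot, hπ, QuotientGroup.ker_mk']
    exact h4
  have h2 : K.map π ⊔ S = ⊤ := by
    refine (hmaxY _ le_sup_left).resolve_left fun h => hSK ?_
    rw [← h]
    exact le_sup_right
  -- The intersection is normalized by the image of `K` and centralized by the abelian `S`, and
  -- these generate.
  have hn : (K.map π ⊓ S).Normal := by
    refine ⟨fun x hx g => ?_⟩
    have hg : g ∈ K.map π ⊔ S := h2 ▸ Subgroup.mem_top g
    rw [Subgroup.mem_sup_of_normal_right] at hg
    obtain ⟨k, hk, s, hs, rfl⟩ := hg
    have e : k * s * x * (k * s)⁻¹ = k * x * k⁻¹ := by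
      have : s * x = x * s := hab s hs x hx.2
      calc k * s * x * (k * s)⁻¹ = k * (s * x) * s⁻¹ * k⁻¹ := by group
        _ = k * x * k⁻¹ := by rw [this]; group
    rw [e]
    exact ⟨(K.map π).mul_mem ((K.map π).mul_mem hk hx.1) ((K.map π).inv_mem hk),
      hSn.conj_mem x hx.2 k⟩
  have h1 : K.map π ⊓ S = ⊥ :=
    (hmin _ hn inf_le_right).resolve_right fun h => hSK (inf_eq_right.1 h)
  have hidx : K.index = Nat.card S := by
    rw [← Subgroup.index_eq_card_of_compl hSn h1 h2,
      ← Subgroup.index_comap_of_surjective _ hsurj, hcm]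
  have hcS : IsMulCommutative S := ⟨⟨fun a b => Subtype.ext (hab _ a.2 _ b.2)⟩⟩
  obtain ⟨m, e, he⟩ := CommGroup.exists_equiv_zmod_of_pow_eq_one hp
    (fun a : S => Subtype.ext (by simpa using hpow _ a.2))
  obtain ⟨ρ, δ, hirr, hst⟩ :=
    Subgroup.exists_isPointStabilizer_of_compl (p := p) hSn hS hmin hab h1 h2 e he
  refine ⟨p, m, hp, ?_, ρ.comp π, fun x => δ (π x), hirr.comp_surjective hsurj, ⟨?_, ?_⟩⟩
  · rw [hidx, ← Nat.card_congr e, Nat.card_fun, Nat.card_zmod, Nat.card_eq_fintype_card,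
      Fintype.card_fin]
  · intro x y
    rw [map_mul, hst.map_mul]
    rfl
  · intro x
    rw [← hst.mem_iff]
    conv_lhs => rw [← hcm]
    rfl

/-! ### Semilinear groups over finite fields -/

open Module

/-- Subgroups of automorphism groups of finite fields are cyclic, and the norm to the fixed field
is surjective. -/
theorem FiniteField.exists_generator_norm {p : ℕ} [Fact p.Prime] {E : Type*} [Field E] [Finite E]
    [Algebra (ZMod p) E] (R : Subgroup (E ≃ₐ[ZMod p] E)) :
    ∃ (s : E ≃ₐ[ZMod p] E) (f : ℕ), s ∈ R ∧ 0 < f ∧ s ^ f = 1 ∧ (∀ g ∈ R, ∃ i : ℕ, g = s ^ i) ∧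
      (∀ i < f, ∀ j < f, s ^ i = s ^ j → i = j) ∧
      ∀ u, s u = u → ∃ l, ∏ i ∈ Finset.range f, (s ^ i) l = u := by
  -- The generator is the Frobenius over the fixed field of `R` and `f` is the degree over it. The
  -- product in the last clause is then the norm.
  let K := IntermediateField.fixedField R
  have := Fintype.ofFinite K
  let φ : E ≃ₐ[K] E := FiniteField.frobeniusAlgEquivOfAlgebraic K E
  have hbij := FiniteField.bijective_frobeniusAlgEquivOfAlgebraic_pow K E
  have hφ : ∀ (n : ℕ) x, (φ ^ n) x = x ^ (Nat.card K ^ n) := by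
    intro n x
    rw [AlgEquiv.coe_pow, FiniteField.coe_frobeniusAlgEquivOfAlgebraic_iterate,
      Fintype.card_eq_nat_card]
  have hsn : ∀ (n : ℕ) x, ((φ.restrictScalars (ZMod p)) ^ n) x = (φ ^ n) x := by
    intro n x
    rw [AlgEquiv.coe_pow, AlgEquiv.coe_pow]
    rfl
  set s : E ≃ₐ[ZMod p] E := φ.restrictScalars (ZMod p) with hs
  have hR : ∀ g ∈ R, ∃ i : ℕ, g = s ^ i := by
    intro g hg
    let g' : E ≃ₐ[K] E := AlgEquiv.ofRingEquiv (f := g.toRingEquiv) (fun x => x.2 ⟨g, hg⟩)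
    obtain ⟨i, hi⟩ := hbij.2 g'
    refine ⟨i, AlgEquiv.ext fun x => ?_⟩
    rw [hsn]
    exact (AlgEquiv.congr_fun hi x).symm
  refine ⟨s, finrank K E, ?_, finrank_pos, ?_, hR, ?_, ?_⟩
  · rw [← IntermediateField.fixingSubgroup_fixedField R, IntermediateField.mem_fixingSubgroup_iff]
    intro x hx
    exact φ.commutes ⟨x, hx⟩
  · refine AlgEquiv.ext fun x => ?_
    have := Fintype.ofFinite E
    rw [hsn, hφ, ← Module.natCard_eq_pow_finrank, ← Fintype.card_eq_nat_card, FiniteField.pow_card]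
    rfl
  · intro i hi j hj hij
    have h1 : φ ^ i = φ ^ j := AlgEquiv.ext fun x => by
      rw [← hsn, ← hsn, hij]
    exact congrArg Fin.val (hbij.1 (a₁ := ⟨i, hi⟩) (a₂ := ⟨j, hj⟩) h1)
  · intro u hu
    have hu' : u ∈ K := by
      rw [IntermediateField.mem_fixedField_iff]
      intro g hg
      obtain ⟨i, rfl⟩ := hR g hg
      rw [AlgEquiv.coe_pow]
      exact Function.iterate_fixed hu i
    obtain ⟨l, hl⟩ := FiniteField.norm_surjective K E ⟨u, hu'⟩
    refine ⟨l, ?_⟩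
    have h2 := FiniteField.algebraMap_norm_eq_prod_pow K E l
    rw [hl] at h2
    rw [show u = algebraMap K E ⟨u, hu'⟩ from rfl, h2]
    exact Finset.prod_congr rfl fun i _ => by rw [hsn, hφ]

/-- An irreducible group of semilinear maps over a finite field `E`, whose `E`-linear members are
scalars, acts on a line. -/
theorem ActsIrreducibly.exists_line {p : ℕ} [Fact p.Prime] {H W E : Type*} [Group H]
    [AddCommGroup W] [Module (ZMod p) W] [Finite W] [Field E] [Finite E] [Algebra (ZMod p) E]
    [Module E W] [IsScalarTower (ZMod p) E W] {τ : H →* Module.End (ZMod p) W}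
    (hτ : ActsIrreducibly τ) (σ : H →* (E ≃ₐ[ZMod p] E))
    (hσ : ∀ h (e : E) w, τ h (e • w) = σ h e • τ h w)
    (hker : ∀ h, σ h = 1 → ∃ c : E, ∀ w, τ h w = c • w) :
    ∃ v : W, v ≠ 0 ∧ ∀ w, ∃ a : E, w = a • v := by
  obtain ⟨s, f, hsR, hf, hsf, hgen, hinj, hnorm⟩ := FiniteField.exists_generator_norm σ.range
  obtain ⟨h₀, rfl⟩ := hsR
  have := hτ.1
  obtain ⟨w₀, hw₀⟩ := exists_ne (0 : W)
  have hτinj : ∀ h, ∀ w, τ h w = 0 → w = 0 := by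
    intro h w hw
    have : τ h⁻¹ (τ h w) = w := by
      rw [← Module.End.mul_apply, ← map_mul, inv_mul_cancel, map_one, Module.End.one_apply]
    rw [← this, hw, map_zero]
  obtain ⟨u, hu⟩ := hker (h₀ ^ f) (by rw [map_pow, hsf])
  have hu0 : u ≠ 0 := by
    rintro rfl
    exact hw₀ (hτinj (h₀ ^ f) w₀ (by rw [hu, zero_smul]))
  have hsu : σ h₀ u = u := by
    have h1 : τ h₀ (τ (h₀ ^ f) w₀) = τ (h₀ ^ f) (τ h₀ w₀) := by
      rw [← Module.End.mul_apply, ← Module.End.mul_apply, ← map_mul, ← map_mul, ← pow_succ,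
        ← pow_succ']
    rw [hu, hu, hσ] at h1
    exact smul_left_injective E (fun h => hw₀ (hτinj _ _ h)) h1
  -- With this norm, the semilinear map `T = l • τ h₀` satisfies `T ^ f = 1`. Below, `a e i` is `T ^
  -- i` applied to `e • w₀`.
  obtain ⟨l, hl⟩ := hnorm u⁻¹ (by rw [map_inv₀, hsu])
  let N : ℕ → E := fun i => ∏ j ∈ Finset.range i, (σ h₀ ^ j) l
  have hN : ∀ i, l * σ h₀ (N i) = N (i + 1) := by
    intro i
    simp only [N]
    rw [Finset.prod_range_succ', map_prod, pow_zero, AlgEquiv.one_apply, mul_comm]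
    congr 1
    refine Finset.prod_congr rfl fun j _ => ?_
    rw [pow_succ', AlgEquiv.mul_apply]
  let a : E → ℕ → W := fun e i => ((σ h₀ ^ i) e * N i) • τ (h₀ ^ i) w₀
  have ha : ∀ e i, l • τ h₀ (a e i) = a e (i + 1) := by
    intro e i
    simp only [a]
    rw [pow_succ' h₀, pow_succ' (σ h₀), AlgEquiv.mul_apply, map_mul τ, Module.End.mul_apply, ← hN,
      hσ, smul_smul, map_mul]
    congr 1
    ring
  have haf : ∀ e, a e f = a e 0 := by
    intro e
    simp only [a]
    rw [hsf, hu, smul_smul, show N f = u⁻¹ from hl]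
    simp [N, hu0]
  -- As in Hilbert 90: independence of the powers of `σ h₀` makes some average over the powers of
  -- `T` nonzero, and that average is fixed by `T`.
  obtain ⟨e, he⟩ : ∃ e, ∑ i ∈ Finset.range f, a e i ≠ 0 := by
    by_contra! hcon
    obtain ⟨ℓ, hℓ⟩ := Projective.exists_dual_ne_zero E hw₀
    have hli : LinearIndependent E
        (fun i : Fin f => (((σ h₀ ^ i.1 : E ≃ₐ[ZMod p] E) : E →* E) : E → E)) :=
      (linearIndependent_monoidHom E E).comp
        (fun i : Fin f => ((σ h₀ ^ i.1 : E ≃ₐ[ZMod p] E) : E →* E)) (by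
          intro i j hij
          exact Fin.ext (hinj _ i.2 _ j.2 (AlgEquiv.ext fun x => DFunLike.congr_fun hij x)))
    have h0 := Fintype.linearIndependent_iff.1 hli (fun i => N i * ℓ (τ (h₀ ^ i.1) w₀)) (by
      funext e
      have h1 := congrArg ℓ (hcon e)
      rw [map_sum, map_zero, Finset.sum_range] at h1
      simp only [a, map_smul, smul_eq_mul] at h1
      rw [Finset.sum_apply]
      simp only [Pi.smul_apply, smul_eq_mul, Pi.zero_apply]
      rw [← h1]
      refine Finset.sum_congr rfl fun i _ => ?_
      change N i * ℓ (τ (h₀ ^ i.1) w₀) * (σ h₀ ^ i.1) e = _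
      ring) ⟨0, hf⟩
    apply hℓ
    simpa [N] using h0
  set v := ∑ i ∈ Finset.range f, a e i with hv
  have hTv : l • τ h₀ v = v := by
    rw [hv, map_sum, Finset.smul_sum, Finset.sum_congr rfl fun i _ => ha e i]
    have h1 := Finset.sum_range_succ (a e) f
    rw [Finset.sum_range_succ', haf e] at h1
    exact add_right_cancel h1
  have hl0 : l ≠ 0 := by
    rintro rfl
    exact he (by rw [← hTv, zero_smul])
  let U : Submodule (ZMod p) W := (LinearMap.toSpanSingleton E W v).range.restrictScalars (ZMod p)
  have hmem : ∀ x, x ∈ U ↔ ∃ b : E, b • v = x := fun x => Iff.rfl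
  have hpow : ∀ k : ℕ, τ (h₀ ^ k) v ∈ U := by
    intro k
    induction k with
    | zero => exact ⟨1, by simp⟩
    | succ k ih =>
      obtain ⟨b, hb⟩ := ih
      refine ⟨σ h₀ b * l⁻¹, ?_⟩
      rw [pow_succ' h₀, map_mul τ, Module.End.mul_apply, ← hb]
      change (σ h₀ b * l⁻¹) • v = τ h₀ (b • v)
      rw [hσ, mul_smul]
      congr 1
      rw [inv_smul_eq_iff₀ hl0, hTv]
  -- The line `E v` is stable: every `h` is a power of `h₀` up to an element of the kernel of `σ`,
  -- and such an element acts as a scalar.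
  have hU := hτ.2 U (by
    intro h x hx
    obtain ⟨b, rfl⟩ := (hmem x).1 hx
    rw [hσ]
    obtain ⟨k, hk⟩ := hgen (σ h) ⟨h, rfl⟩
    obtain ⟨c, hc⟩ := hker (h * (h₀ ^ k)⁻¹) (by rw [map_mul, map_inv, map_pow, hk, mul_inv_cancel])
    obtain ⟨d, hd⟩ := (hmem _).1 (hpow k)
    rw [hmem]
    refine ⟨σ h b * (c * d), ?_⟩
    rw [mul_smul, mul_smul, hd, ← hc, ← Module.End.mul_apply, ← map_mul, inv_mul_cancel_right])
  refine ⟨v, he, fun w => ?_⟩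
  have hUt : U = ⊤ := by
    refine hU.resolve_left fun h => he ?_
    have : v ∈ U := ⟨1, by simp⟩
    rwa [h, Submodule.mem_bot] at this
  obtain ⟨b, hb⟩ := (hmem w).1 (hUt ▸ Submodule.mem_top)
  exact ⟨b, hb.symm⟩

/-! ### Induced modules and primitivity -/

/-- `ρ` is induced from the subspace `U`, stable under the subgroup `L`. -/
structure IsInducedFrom {p : ℕ} {X V : Type*} [Group X] [AddCommGroup V] [Module (ZMod p) V]
    (ρ : X →* Module.End (ZMod p) V) (L : Subgroup X) (U : Submodule (ZMod p) V) : Prop where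
  stable : ∀ h ∈ L, ∀ u ∈ U, ρ h u ∈ U
  iSup_map : ⨆ h, U.map (ρ h) = ⊤
  card_eq : Nat.card V = Nat.card U ^ L.index

theorem MonoidHom.end_inv_apply {p : ℕ} {X V : Type*} [Group X] [AddCommGroup V]
    [Module (ZMod p) V] (ρ : X →* Module.End (ZMod p) V) (x : X) (v : V) :
    ρ x⁻¹ (ρ x v) = v := by
  rw [← Module.End.mul_apply, ← map_mul, inv_mul_cancel, map_one, Module.End.one_apply]

theorem MonoidHom.end_apply_inv {p : ℕ} {X V : Type*} [Group X] [AddCommGroup V]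
    [Module (ZMod p) V] (ρ : X →* Module.End (ZMod p) V) (x : X) (v : V) :
    ρ x (ρ x⁻¹ v) = v := by
  rw [← Module.End.mul_apply, ← map_mul, mul_inv_cancel, map_one, Module.End.one_apply]

theorem ActsIrreducibly.iSup_map_eq_top {p : ℕ} {X V : Type*} [Group X] [AddCommGroup V]
    [Module (ZMod p) V] {ρ : X →* Module.End (ZMod p) V} (hρ : ActsIrreducibly ρ)
    {U : Submodule (ZMod p) V} (hU : U ≠ ⊥) : ⨆ h, U.map (ρ h) = ⊤ := by
  refine (hρ.2 _ ?_).resolve_left ?_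
  · intro g u hu
    have : (⨆ h, U.map (ρ h)) ≤ (⨆ h, U.map (ρ h)).comap (ρ g) := by
      refine iSup_le fun h => ?_
      rintro _ ⟨u, hu, rfl⟩
      refine Submodule.mem_iSup_of_mem (g * h) ⟨u, hu, ?_⟩
      rw [map_mul, Module.End.mul_apply]
    exact this hu
  · intro h
    apply hU
    rw [eq_bot_iff, ← h]
    refine le_iSup_of_le 1 ?_
    rw [map_one]
    exact (Submodule.map_id U).ge

/-- If a commutative ring `E` acts compatibly with an irreducible group of semilinear maps, then
the module is induced from the torsion submodule of a maximal ideal of `E`. -/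
theorem ActsIrreducibly.exists_maximal_annihilator {p : ℕ} {H W E : Type*} [Group H]
    [AddCommGroup W] [Module (ZMod p) W] [Finite W] [CommRing E] [Finite E] [Algebra (ZMod p) E]
    [Module E W] [IsScalarTower (ZMod p) E W] {τ : H →* Module.End (ZMod p) W}
    (hτ : ActsIrreducibly τ) (σ : H →* (E ≃ₐ[ZMod p] E))
    (hσ : ∀ h (e : E) w, τ h (e • w) = σ h e • τ h w)
    (hprim : ∀ L U, IsInducedFrom τ L U → U = ⊤) :
    ∃ I : Ideal E, I.IsMaximal ∧ ∀ e ∈ I, ∀ w : W, e • w = 0 := by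
  classical
  have := hτ.1
  obtain ⟨S, hS⟩ := IsAtomic.exists_atom (Submodule E W)
  have hSs : IsSimpleModule E S := isSimpleModule_iff_isAtom.2 hS
  let I : Ideal E := Module.annihilator E S
  have hI : I.IsMaximal := IsSimpleModule.annihilator_isMaximal
  -- `J h` is the transport of `I` by `σ h`, so its torsion is the translate of `U` by `τ h`.
  -- Distinct translates come from distinct, hence coprime, maximal ideals and so form a direct sum.
  let J : H → Ideal E := fun h => I.comap (σ h⁻¹ : E ≃ₐ[ZMod p] E).toRingEquiv
  have hJ : ∀ h, (J h).IsMaximal := fun h => Ideal.comap_isMaximal_of_equiv _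
  let T : H → Submodule E W := fun h => Submodule.torsionBySet E W (J h)
  have hσinv : ∀ h e, σ h⁻¹ (σ h e) = e := fun h e => by
    rw [← AlgEquiv.mul_apply, ← map_mul, inv_mul_cancel, map_one, AlgEquiv.one_apply]
  have hσinv' : ∀ h e, σ h (σ h⁻¹ e) = e := fun h e => by
    rw [← AlgEquiv.mul_apply, ← map_mul, mul_inv_cancel, map_one, AlgEquiv.one_apply]
  let U : Submodule (ZMod p) W := (Submodule.torsionBySet E W I).restrictScalars (ZMod p)
  have hUmem : ∀ w, w ∈ U ↔ ∀ e ∈ I, e • w = 0 := fun w => by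
    simp [U, Submodule.mem_torsionBySet_iff]
  have hmapmem : ∀ h w, w ∈ U.map (τ h) ↔ τ h⁻¹ w ∈ U := by
    intro h w
    constructor
    · rintro ⟨u, hu, rfl⟩
      rwa [MonoidHom.end_inv_apply]
    · intro hw
      exact ⟨_, hw, MonoidHom.end_apply_inv τ h w⟩
  have hT : ∀ h, (T h).restrictScalars (ZMod p) = U.map (τ h) := by
    intro h
    ext w
    rw [hmapmem, hUmem, Submodule.restrictScalars_mem]
    simp only [T, Submodule.mem_torsionBySet_iff, Subtype.forall]
    constructor
    · intro hw e he
      have h1 : σ h e ∈ J h := by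
        change σ h⁻¹ (σ h e) ∈ I
        rwa [hσinv]
      have h2 := congrArg (τ h⁻¹) (hw _ h1)
      rwa [hσ, hσinv, map_zero] at h2
    · intro hw e he
      have h2 := congrArg (τ h) (hw _ he)
      rw [hσ, map_zero, MonoidHom.end_apply_inv] at h2
      change σ h (σ h⁻¹ e) • w = 0 at h2
      rwa [hσinv'] at h2
  have hU0 : U ≠ ⊥ := by
    obtain ⟨x, hx, hx0⟩ := S.ne_bot_iff.1 hS.1
    intro h
    apply hx0
    have : x ∈ U := (hUmem x).2 fun e he =>
      congrArg Subtype.val (Module.mem_annihilator.1 he (⟨x, hx⟩ : S))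
    rwa [h, Submodule.mem_bot] at this
  -- Summing over the orbit of `U` counts each translate once; the inducing subgroup is the
  -- stabilizer of `U`.
  let act : MulAction H (Submodule (ZMod p) W) :=
    { smul := fun h P => P.map (τ h)
      one_smul := fun P => by
        change P.map (τ 1) = P
        rw [map_one]
        exact Submodule.map_id P
      mul_smul := fun g h P => by
        change P.map (τ (g * h)) = (P.map (τ h)).map (τ g)
        rw [map_mul, ← Submodule.map_comp]
        rfl }
  let O := MulAction.orbit H U
  have hOfin : Fintype O := Fintype.ofFinite _
  have hOch : ∀ P : O, ∃ h : H, U.map (τ h) = P := fun P => P.2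
  choose c hc using hOch
  have hindep : iSupIndep fun P : O => T (c P) := by
    rw [iSupIndep_iff_supIndep_univ]
    apply Submodule.supIndep_torsionBySet_ideal
    intro P _ Q _ hPQ
    refine Ideal.IsMaximal.coprime_of_ne (hJ _) (hJ _) fun h => hPQ ?_
    apply Subtype.ext
    rw [← hc P, ← hc Q, ← hT, ← hT]
    simp only [T, h]
  have htop : ⨆ P : O, T (c P) = ⊤ := by
    rw [eq_top_iff]
    intro w _
    have hw : w ∈ ⨆ h, U.map (τ h) := by
      rw [hτ.iSup_map_eq_top hU0]
      exact Submodule.mem_top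
    have hle : (⨆ h, U.map (τ h)) ≤ (⨆ P : O, T (c P)).restrictScalars (ZMod p) := by
      refine iSup_le fun h => ?_
      let P : O := ⟨U.map (τ h), h, rfl⟩
      rw [show U.map (τ h) = P from rfl, ← hc P, ← hT]
      exact fun x hx => (le_iSup (fun P : O => T (c P)) P) hx
    exact hle hw
  have hint := DirectSum.isInternal_submodule_of_iSupIndep_of_iSup_eq_top hindep htop
  have hcardT : ∀ h, Nat.card (T h) = Nat.card U := by
    intro h
    rw [show Nat.card (T h) = Nat.card ((T h).restrictScalars (ZMod p)) from rfl, hT]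
    refine (Nat.card_congr (Submodule.equivMapOfInjective (τ h) ?_ U).toEquiv).symm
    exact Function.LeftInverse.injective (MonoidHom.end_inv_apply τ h)
  have hcard : Nat.card W = Nat.card U ^ Nat.card O := by
    have e1 := Nat.card_congr (Equiv.ofBijective _ hint)
    rw [← e1]
    refine (Nat.card_congr (DFinsupp.equivFunOnFintype (β := fun P : O => T (c P)))).trans ?_
    rw [Nat.card_pi]
    simp only [hcardT]
    rw [Finset.prod_const, Finset.card_univ, Nat.card_eq_fintype_card (α := O)]
  have hUt : U = ⊤ := by
    refine hprim (MulAction.stabilizer H U) U ⟨?_, hτ.iSup_map_eq_top hU0, ?_⟩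
    · intro h hh u hu
      have : U.map (τ h) = U := hh
      rw [← this]
      exact ⟨u, hu, rfl⟩
    · rw [MulAction.index_stabilizer, hcard, ← Nat.card_coe_set_eq]
  refine ⟨I, hI, fun e he w => ?_⟩
  exact (hUmem w).1 (hUt ▸ Submodule.mem_top) e he

/-! ### Primitive modules are semilinear of dimension one -/

/-- In an `IsElemAGroup`, a maximal normal subgroup with commutative image is its own centralizer
relative to the given homomorphism. -/
theorem IsElemAGroup.exists_normal_self_centralizing {H M : Type*} [Group H] [Monoid M]
    (hH : IsElemAGroup H) (τ : H →* M) :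
    ∃ A : Subgroup H, A.Normal ∧ (∀ a ∈ A, ∀ b ∈ A, Commute (τ a) (τ b)) ∧
      ∀ h, (∀ a ∈ A, Commute (τ h) (τ a)) → h ∈ A := by
  have := hH.finite
  obtain ⟨A, hA⟩ := Set.Finite.exists_maximal
    (s := {A : Subgroup H | A.Normal ∧ ∀ a ∈ A, ∀ b ∈ A, Commute (τ a) (τ b)}) (Set.toFinite _)
    ⟨⊥, inferInstance, fun a ha b hb => by
      rw [Subgroup.mem_bot] at ha
      rw [ha, map_one]
      exact Commute.one_left _⟩
  obtain ⟨hAn, hAc⟩ := hA.prop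
  refine ⟨A, hAn, hAc, ?_⟩
  let C : Subgroup H :=
    { carrier := {h | ∀ a ∈ A, Commute (τ h) (τ a)}
      one_mem' := fun a _ => by
        rw [map_one]
        exact Commute.one_left _
      mul_mem' := fun {x y} hx hy a ha => by
        rw [map_mul]
        exact (hx a ha).mul_left (hy a ha)
      inv_mem' := fun {x} hx a ha => by
        have h1 : τ (x * a) = τ (a * x) := by
          rw [map_mul, map_mul]
          exact hx a ha
        change τ x⁻¹ * τ a = τ a * τ x⁻¹
        calc τ x⁻¹ * τ a = τ x⁻¹ * τ (a * x) * τ x⁻¹ := by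
              rw [← map_mul, ← map_mul, ← map_mul]
              congr 1
              group
          _ = τ a * τ x⁻¹ := by
              rw [← h1, ← map_mul, ← map_mul, ← map_mul]
              congr 1
              group }
  have hCn : C.Normal := by
    refine ⟨fun x hx g a ha => ?_⟩
    have h2 : τ (x * (g⁻¹ * a * g)) = τ (g⁻¹ * a * g * x) := by
      have := hx (g⁻¹ * a * g) (by simpa using hAn.conj_mem a ha g⁻¹)
      rw [map_mul τ x, map_mul τ _ x]
      exact this
    change τ (g * x * g⁻¹) * τ a = τ a * τ (g * x * g⁻¹)
    calc τ (g * x * g⁻¹) * τ a = τ g * τ (x * (g⁻¹ * a * g)) * τ g⁻¹ := by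
          rw [← map_mul, ← map_mul, ← map_mul]
          congr 1
          group
      _ = τ a * τ (g * x * g⁻¹) := by
          rw [h2, ← map_mul, ← map_mul, ← map_mul]
          congr 1
          group
  have hAC : A ≤ C := fun a ha b hb => hAc a ha b hb
  intro h hh
  have hhC : h ∈ C := hh
  by_contra hhA
  have hQ := hH.quotient A
  have := hQ.finite
  have := hQ.solvable
  have hsurj := QuotientGroup.mk'_surjective A
  have hmk : ∀ x, QuotientGroup.mk' A x = 1 ↔ x ∈ A := fun x => QuotientGroup.eq_one_iff x
  have hCmn : (C.map (QuotientGroup.mk' A)).Normal := hCn.map _ hsurj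
  -- If `C` exceeds `A`, a minimal normal subgroup of `H ⧸ A` inside `C ⧸ A` is a `q`-group and is
  -- covered by a `q`-subgroup `R`, which is abelian. Its preimage `B` is a product of elements of
  -- `R ⊓ C` and `A`, so it again has commutative image, against maximality.
  obtain ⟨S, hSn, hSC, hS, -, q, hq, -, hpow⟩ :=
    (C.map (QuotientGroup.mk' A)).exists_minimal_normal_le (by
      intro h0
      have : QuotientGroup.mk' A h ∈ C.map (QuotientGroup.mk' A) := ⟨h, hhC, rfl⟩
      rw [h0, Subgroup.mem_bot, hmk] at this
      exact hhA this)
  obtain ⟨R, hR, hSR⟩ := IsPGroup.exists_lift hsurj hq (P := S)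
    (fun x => ⟨1, Subtype.ext (by simpa using hpow x x.2)⟩)
  let B := S.comap (QuotientGroup.mk' A)
  have hBC : B ≤ C := by
    have := Subgroup.comap_mono (f := QuotientGroup.mk' A) hSC
    rwa [Subgroup.comap_map_eq, QuotientGroup.ker_mk', sup_eq_left.2 hAC] at this
  have hAB : A ≤ B := fun a ha => by
    change QuotientGroup.mk' A a ∈ S
    rw [(hmk a).2 ha]
    exact one_mem S
  have hdec : ∀ b ∈ B, ∃ r ∈ R, ∃ a ∈ A, r ∈ C ∧ b = r * a := by
    intro b hb
    obtain ⟨r, hr, hrb⟩ := hSR hb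
    have ha : r⁻¹ * b ∈ A := by
      rw [← hmk, map_mul, map_inv, hrb, inv_mul_cancel]
    refine ⟨r, hr, r⁻¹ * b, ha, ?_, by group⟩
    have : r = b * (r⁻¹ * b)⁻¹ := by group
    rw [this]
    exact mul_mem (hBC hb) (inv_mem (hAC ha))
  have hBc : ∀ x ∈ B, ∀ y ∈ B, Commute (τ x) (τ y) := by
    intro x hx y hy
    obtain ⟨r, hr, a, ha, hrC, rfl⟩ := hdec x hx
    obtain ⟨s, hs, b, hb, hsC, rfl⟩ := hdec y hy
    rw [map_mul, map_mul]
    have h1 : Commute (τ r) (τ s) := by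
      change τ r * τ s = τ s * τ r
      rw [← map_mul, hH.comm q hq R hR r hr s hs, map_mul]
    exact (h1.mul_right (hrC b hb)).mul_left (((hsC a ha).symm).mul_right (hAc a ha b hb))
  have hBA : B ≤ A := hA.le_of_ge ⟨inferInstance, hBc⟩ hAB
  apply hS
  rw [eq_bot_iff]
  intro x hx
  obtain ⟨y, rfl⟩ := hsurj x
  rw [Subgroup.mem_bot, hmk]
  exact hBA hx

/-- The action by conjugation on an invariant subalgebra of the endomorphism algebra. -/
def Subalgebra.conjAction {p : ℕ} {H W : Type*} [Group H] [AddCommGroup W] [Module (ZMod p) W]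
    (τ : H →* Module.End (ZMod p) W) (E : Subalgebra (ZMod p) (Module.End (ZMod p) W))
    (hE : ∀ h, ∀ e ∈ E, τ h * e * τ h⁻¹ ∈ E) : H →* (E ≃ₐ[ZMod p] E) :=
  have hinv : ∀ h, τ h * τ h⁻¹ = 1 := fun h => by rw [← map_mul, mul_inv_cancel, map_one]
  have hinv' : ∀ h, τ h⁻¹ * τ h = 1 := fun h => by rw [← map_mul, inv_mul_cancel, map_one]
  let f : H →* (E →ₐ[ZMod p] E) :=
    { toFun := fun h => AlgHom.ofLinearMap
        { toFun := fun e => ⟨τ h * e * τ h⁻¹, hE h e e.2⟩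
          map_add' := fun a b => Subtype.ext (by simp [mul_add, add_mul])
          map_smul' := fun a b => Subtype.ext (by simp) }
        (Subtype.ext (by simp [hinv]))
        (fun a b => Subtype.ext (by
          change τ h * (a * b) * τ h⁻¹ = (τ h * a * τ h⁻¹) * (τ h * b * τ h⁻¹)
          calc τ h * ((a : Module.End (ZMod p) W) * b) * τ h⁻¹
              = τ h * a * 1 * b * τ h⁻¹ := by simp only [mul_assoc, one_mul]
            _ = _ := by rw [← hinv' h]; simp only [mul_assoc]))
      map_one' := by
        ext e
        simp
      map_mul' := fun g h => AlgHom.ext fun e => Subtype.ext (by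
        change τ (g * h) * e * τ (g * h)⁻¹ = τ g * (τ h * e * τ h⁻¹) * τ g⁻¹
        rw [mul_inv_rev, map_mul, map_mul]
        simp only [mul_assoc]) }
  (AlgEquiv.algHomUnitsEquiv (ZMod p) E : _ →* (E ≃ₐ[ZMod p] E)).comp f.toHomUnits

theorem Subalgebra.coe_conjAction {p : ℕ} {H W : Type*} [Group H] [AddCommGroup W]
    [Module (ZMod p) W] (τ : H →* Module.End (ZMod p) W)
    (E : Subalgebra (ZMod p) (Module.End (ZMod p) W))
    (hE : ∀ h, ∀ e ∈ E, τ h * e * τ h⁻¹ ∈ E) (h : H) (e : E) :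
    (Subalgebra.conjAction τ E hE h e : Module.End (ZMod p) W) = τ h * e * τ h⁻¹ := rfl

open scoped IsMulCommutative in
/-- A primitive irreducible action of an `IsElemAGroup` is semilinear on a line over a finite
field. -/
theorem ActsIrreducibly.exists_semilinear {p : ℕ} [Fact p.Prime] {H W : Type*} [Group H]
    (hH : IsElemAGroup H) [AddCommGroup W] [Module (ZMod p) W] [Finite W]
    {τ : H →* Module.End (ZMod p) W} (hτ : ActsIrreducibly τ)
    (hprim : ∀ L U, IsInducedFrom τ L U → U = ⊤) {m : ℕ} (hm : Nat.card W = p ^ m) :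
    ∃ j : GaloisField p m ≃+ W, ∀ h, ∃ (c : GaloisField p m)
      (s : GaloisField p m ≃ₐ[ZMod p] GaloisField p m), ∀ a, τ h (j a) = j (c * s a) := by
  obtain ⟨A, hAn, hAc, hAcent⟩ := hH.exists_normal_self_centralizing τ
  let E := Algebra.adjoin (ZMod p) (τ '' A)
  have hEc : IsMulCommutative E := Algebra.isMulCommutative_adjoin _ (by
    rintro _ ⟨a, ha, rfl⟩ _ ⟨b, hb, rfl⟩
    exact hAc a ha b hb)
  have : Finite (Module.End (ZMod p) W) := DFunLike.finite _
  have hmem : ∀ a ∈ A, τ a ∈ E := fun a ha => Algebra.subset_adjoin ⟨a, ha, rfl⟩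
  have hinv : ∀ h, τ h * τ h⁻¹ = 1 := fun h => by rw [← map_mul, mul_inv_cancel, map_one]
  have hinv' : ∀ h, τ h⁻¹ * τ h = 1 := fun h => by rw [← map_mul, inv_mul_cancel, map_one]
  have hE : ∀ h, ∀ e ∈ E, τ h * e * τ h⁻¹ ∈ E := by
    intro h e he
    induction he using Algebra.adjoin_induction with
    | mem x hx =>
      obtain ⟨a, ha, rfl⟩ := hx
      rw [← map_mul, ← map_mul]
      exact hmem _ (hAn.conj_mem a ha h)
    | algebraMap r =>
      rw [← Algebra.commutes, mul_assoc, hinv, mul_one]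
      exact E.algebraMap_mem r
    | add x y _ _ hx hy =>
      rw [mul_add, add_mul]
      exact add_mem hx hy
    | mul x y _ _ hx hy =>
      have : τ h * (x * y) * τ h⁻¹ = (τ h * x * τ h⁻¹) * (τ h * y * τ h⁻¹) := by
        calc τ h * (x * y) * τ h⁻¹ = τ h * x * 1 * y * τ h⁻¹ := by simp only [mul_assoc, one_mul]
          _ = _ := by rw [← hinv' h]; simp only [mul_assoc]
      rw [this]
      exact mul_mem hx hy
  let σ := Subalgebra.conjAction τ E hE
  have hsm : ∀ (e : E) (w : W), e • w = (e : Module.End (ZMod p) W) w := fun _ _ => rfl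
  have hσ : ∀ h (e : E) w, τ h (e • w) = σ h e • τ h w := by
    intro h e w
    rw [hsm, hsm, Subalgebra.coe_conjAction, Module.End.mul_apply, Module.End.mul_apply,
      MonoidHom.end_inv_apply]
  obtain ⟨I, hI, hIW⟩ := hτ.exists_maximal_annihilator σ hσ hprim
  -- `E` consists of endomorphisms, so it acts faithfully. A maximal ideal killing `W` is therefore
  -- zero, and `E` is a field.
  have hI0 : I = ⊥ := by
    rw [eq_bot_iff]
    intro e he
    exact Subtype.ext (LinearMap.ext fun w => hIW e he w)
  rw [hI0] at hI
  have := hτ.1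
  have hfield : IsField E := Ring.isField_iff_maximal_bot.2 hI
  let := hfield.toField
  -- If `h` acts trivially on `E` then `τ h` commutes with `τ '' A`, so `h ∈ A`, and `τ h` is itself
  -- a scalar from `E`.
  obtain ⟨v, hv, hspan⟩ := hτ.exists_line σ hσ (by
    intro h hh
    have hhA : h ∈ A := hAcent h fun a ha => by
      have h1 := congrArg Subtype.val (AlgEquiv.congr_fun hh ⟨τ a, hmem a ha⟩)
      rw [Subalgebra.coe_conjAction, AlgEquiv.one_apply] at h1
      change τ h * τ a = τ a * τ h
      calc τ h * τ a = τ h * τ a * τ h⁻¹ * τ h := by rw [mul_assoc _ (τ h⁻¹), hinv', mul_one]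
        _ = _ := by rw [h1]
    exact ⟨⟨τ h, hmem h hhA⟩, fun w => rfl⟩)
  let f : E →+ W := AddMonoidHom.mk' (fun a => a • v) fun a b => add_smul a b v
  have hf : Function.Bijective f := by
    refine ⟨fun a b hab => smul_left_injective E hv hab, fun w => ?_⟩
    obtain ⟨a, rfl⟩ := hspan w
    exact ⟨a, rfl⟩
  let F : E ≃+ W := AddEquiv.ofBijective f hf
  have hcE : Nat.card E = p ^ m := by rw [← hm, Nat.card_congr F.toEquiv]
  let g : E ≃ₐ[ZMod p] GaloisField p m := GaloisField.algEquivGaloisField p m hcE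
  refine ⟨g.symm.toAddEquiv.trans F, fun h => ?_⟩
  obtain ⟨c, hc⟩ := hspan (τ h v)
  refine ⟨g c, (g.symm.trans (σ h)).trans g, fun a => ?_⟩
  change τ h (g.symm a • v) = g.symm (g c * g (σ h (g.symm a))) • v
  rw [hσ, hc, ← map_mul, AlgEquiv.symm_apply_apply, smul_smul, mul_comm]

/-! ### Induced modules are determined by the inducing data -/

/-- `ρ` is induced from the action `ψ` of the subgroup `L` on `K`. -/
structure IsInducedAlong {p : ℕ} {X V K : Type*} [Group X] [AddCommGroup V] [Module (ZMod p) V]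
    [AddCommGroup K] (ρ : X →* Module.End (ZMod p) V) (L : Subgroup X) (ψ : L →* Function.End K)
    (j : K →+ V) : Prop where
  map_apply : ∀ (h : L) a, j (ψ h a) = ρ h (j a)
  closure_eq : AddSubgroup.closure {v | ∃ x a, v = ρ x (j a)} = ⊤
  card_eq : Nat.card V = Nat.card K ^ L.index

/-- The additive map spreading `K` along the cosets of `L`. -/
noncomputable def inductionMap {p : ℕ} {X V K : Type*} [Group X] [AddCommGroup V]
    [Module (ZMod p) V] [AddCommGroup K] (ρ : X →* Module.End (ZMod p) V) (L : Subgroup X)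
    [Fintype (X ⧸ L)] (j : K →+ V) : (X ⧸ L → K) →+ V :=
  AddMonoidHom.mk' (fun f => ∑ q : X ⧸ L, ρ q.out (j (f q))) fun a b => by
    simp [Finset.sum_add_distrib]

theorem inductionMap_single {p : ℕ} {X V K : Type*} [Group X] [AddCommGroup V]
    [Module (ZMod p) V] [AddCommGroup K] (ρ : X →* Module.End (ZMod p) V) (L : Subgroup X)
    [Fintype (X ⧸ L)] [DecidableEq (X ⧸ L)] (j : K →+ V) (q : X ⧸ L) (a : K) :
    inductionMap ρ L j (Pi.single q a) = ρ q.out (j a) := by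
  change ∑ r : X ⧸ L, ρ r.out (j ((Pi.single q a : X ⧸ L → K) r)) = _
  rw [Finset.sum_eq_single q]
  · simp
  · intro r _ hr
    simp [Pi.single_eq_of_ne hr]
  · simp

section

variable {p : ℕ} {X V K : Type*} [Group X] [AddCommGroup V] [Module (ZMod p) V] [AddCommGroup K]
  {ρ : X →* Module.End (ZMod p) V} {L : Subgroup X} {ψ : L →* Function.End K} {j : K →+ V}

theorem inductionMap_single_of_map_apply [Fintype (X ⧸ L)] [DecidableEq (X ⧸ L)]
    (hj : ∀ (h : L) a, j (ψ h a) = ρ h (j a)) (x : X) (a : K) :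
    inductionMap ρ L j (Pi.single (x : X ⧸ L) (ψ ⟨(x : X ⧸ L).out⁻¹ * x,
      QuotientGroup.eq.1 (QuotientGroup.out_eq' _)⟩ a)) = ρ x (j a) := by
  rw [inductionMap_single, hj, ← Module.End.mul_apply, ← map_mul, mul_inv_cancel_left]

theorem inductionMap_surjective [Fintype (X ⧸ L)] (hj : ∀ (h : L) a, j (ψ h a) = ρ h (j a))
    (hc : AddSubgroup.closure {v | ∃ x a, v = ρ x (j a)} = ⊤) :
    Function.Surjective (inductionMap ρ L j) := by
  classical
  rw [← AddMonoidHom.range_eq_top, eq_top_iff, ← hc, AddSubgroup.closure_le]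
  rintro _ ⟨x, a, rfl⟩
  exact ⟨_, inductionMap_single_of_map_apply hj x a⟩

theorem IsInducedAlong.bijective [Finite X] [Finite K] [Fintype (X ⧸ L)]
    (h : IsInducedAlong ρ L ψ j) : Function.Bijective (inductionMap ρ L j) := by
  have hs := inductionMap_surjective h.map_apply h.closure_eq
  refine (Nat.bijective_iff_surjective_and_card _).2 ⟨hs, ?_⟩
  rw [h.card_eq, Nat.card_fun, Subgroup.index]

/-- Both modules are identified with `X ⧸ L → K`. The coordinates of `ρ x (j a)` involve only coset
representatives and `ψ`, so they agree on the two sides. Hence `(L, ψ)` determines `ρ` up to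
isomorphism. -/
theorem IsInducedAlong.exists_equiv [Finite X] [Finite K] {V' : Type*} [AddCommGroup V']
    [Module (ZMod p) V'] {ρ' : X →* Module.End (ZMod p) V'} {j' : K →+ V'}
    (h : IsInducedAlong ρ L ψ j) (h' : IsInducedAlong ρ' L ψ j') :
    ∃ φ : V ≃+ V', ∀ x v, φ (ρ x v) = ρ' x (φ v) := by
  classical
  have := Fintype.ofFinite (X ⧸ L)
  let e := AddEquiv.ofBijective _ h.bijective
  let e' := AddEquiv.ofBijective _ h'.bijective
  have key : ∀ x a, e' (e.symm (ρ x (j a))) = ρ' x (j' a) := by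
    intro x a
    rw [← inductionMap_single_of_map_apply h.map_apply x a,
      ← inductionMap_single_of_map_apply h'.map_apply x a]
    exact congrArg e' (e.symm_apply_apply _)
  refine ⟨e.symm.trans e', fun x v => ?_⟩
  have hv : v ∈ AddSubgroup.closure {v | ∃ x a, v = ρ x (j a)} := by
    rw [h.closure_eq]
    exact AddSubgroup.mem_top v
  induction hv using AddSubgroup.closure_induction with
  | mem v hv =>
    obtain ⟨y, a, rfl⟩ := hv
    change e' (e.symm (ρ x (ρ y (j a)))) = ρ' x (e' (e.symm (ρ y (j a))))
    rw [key, ← Module.End.mul_apply, ← map_mul, key, map_mul, Module.End.mul_apply]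
  | zero => simp
  | add v w _ _ hv hw => rw [map_add, map_add, hv, hw, map_add, map_add]
  | neg v _ hv => rw [map_neg, map_neg, hv, map_neg, map_neg]

end

section

variable {p : ℕ} {X V : Type*} [Group X] [AddCommGroup V] [Module (ZMod p) V]

/-- The action of a subgroup on a stable subspace. -/
def restrictAction (ρ : X →* Module.End (ZMod p) V) (L : Subgroup X) (U : Submodule (ZMod p) V)
    (h : ∀ x ∈ L, ∀ u ∈ U, ρ x u ∈ U) : L →* Module.End (ZMod p) U where
  toFun x := (ρ x).restrict (h x x.2)
  map_one' := by
    ext u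
    simp
  map_mul' x y := by
    ext u
    simp

theorem card_le_of_iSup_map_eq_top [Finite X] [Finite V] {ρ : X →* Module.End (ZMod p) V}
    {L : Subgroup X} {U : Submodule (ZMod p) V} (h : ∀ x ∈ L, ∀ u ∈ U, ρ x u ∈ U)
    (htop : ⨆ x, U.map (ρ x) = ⊤) : Nat.card V ≤ Nat.card U ^ L.index := by
  have := Fintype.ofFinite (X ⧸ L)
  let ψ : L →* Function.End U :=
    { toFun := fun x u => restrictAction ρ L U h x u
      map_one' := by
        rw [map_one]
        rfl
      map_mul' := fun x y => by
        rw [map_mul]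
        rfl }
  have hs := inductionMap_surjective (ρ := ρ) (L := L) (ψ := ψ) (j := U.subtype.toAddMonoidHom)
    (fun _ _ => rfl) (by
      rw [eq_top_iff]
      intro v _
      have hle : (⨆ x, U.map (ρ x)) ≤ AddSubgroup.toZModSubmodule p
          (AddSubgroup.closure {v | ∃ x, ∃ a : U, v = ρ x (U.subtype.toAddMonoidHom a)}) := by
        refine iSup_le fun x => ?_
        rintro _ ⟨u, hu, rfl⟩
        exact AddSubgroup.subset_closure ⟨x, ⟨u, hu⟩, rfl⟩
      exact hle (htop ▸ Submodule.mem_top))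
  have := Nat.card_le_card_of_surjective _ hs
  rwa [Nat.card_fun] at this

theorem Submodule.eq_top_of_natCard_le {U : Submodule (ZMod p) V} [Finite V]
    (h : Nat.card V ≤ Nat.card U) : U = ⊤ := by
  have : (U : Set V) = Set.univ := by
    refine Set.eq_of_subset_of_ncard_le (Set.subset_univ _) ?_
    rw [Set.ncard_univ, ← Nat.card_coe_set_eq]
    exact h
  exact SetLike.coe_injective this

theorem IsInducedFrom.trans {ρ : X →* Module.End (ZMod p) V}
    {L : Subgroup X} {U : Submodule (ZMod p) V} (h : IsInducedFrom ρ L U) {L' : Subgroup L}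
    {U' : Submodule (ZMod p) U} (h' : IsInducedFrom (restrictAction ρ L U h.stable) L' U') :
    IsInducedFrom ρ (L'.map L.subtype) (U'.map U.subtype) := by
  refine ⟨?_, ?_, ?_⟩
  · rintro _ ⟨x, hx, rfl⟩ _ ⟨u, hu, rfl⟩
    exact ⟨_, h'.stable x hx u hu, rfl⟩
  · rw [eq_top_iff, ← h.iSup_map]
    refine iSup_le fun x => ?_
    rintro _ ⟨u, hu, rfl⟩
    have hle : (⨆ y, U'.map (restrictAction ρ L U h.stable y)) ≤
        (⨆ x, (U'.map U.subtype).map (ρ x)).comap ((ρ x).comp U.subtype) := by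
      refine iSup_le fun y => ?_
      rintro _ ⟨w, hw, rfl⟩
      refine Submodule.mem_iSup_of_mem (x * y) ⟨w, ⟨w, hw, rfl⟩, ?_⟩
      rw [map_mul]
      rfl
    have h1 : (⟨u, hu⟩ : U) ∈ ⨆ y, U'.map (restrictAction ρ L U h.stable y) := by
      rw [h'.iSup_map]
      exact Submodule.mem_top
    exact hle h1
  · have h1 : Nat.card (U'.map U.subtype) = Nat.card U' :=
      (Nat.card_congr (Submodule.equivMapOfInjective _ U.injective_subtype U').toEquiv).symm
    rw [h.card_eq, h'.card_eq, h1, Subgroup.index_map_subtype, pow_mul]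

/-- An irreducible action is induced from a primitive irreducible one. -/
theorem ActsIrreducibly.exists_primitive [Finite X] [Finite V] {ρ : X →* Module.End (ZMod p) V}
    (hρ : ActsIrreducibly ρ) :
    ∃ (L : Subgroup X) (U : Submodule (ZMod p) V) (h : IsInducedFrom ρ L U),
      ActsIrreducibly (restrictAction ρ L U h.stable) ∧
      ∀ L' U', IsInducedFrom (restrictAction ρ L U h.stable) L' U' → U' = ⊤ := by
  have := hρ.1
  have htop : IsInducedFrom ρ ⊤ ⊤ := by
    refine ⟨fun _ _ _ _ => Submodule.mem_top, hρ.iSup_map_eq_top top_ne_bot, ?_⟩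
    rw [Subgroup.index_top, pow_one]
    exact (Nat.card_congr (Submodule.topEquiv (R := ZMod p) (M := V)).toEquiv).symm
  -- Primitivity comes from minimality of `U`, since induction is transitive.
  obtain ⟨⟨L, U⟩, hLU, hmin⟩ := Set.exists_min_image
    {q : Subgroup X × Submodule (ZMod p) V | IsInducedFrom ρ q.1 q.2} (fun q => Nat.card q.2)
    (Set.toFinite _) ⟨(⊤, ⊤), htop⟩
  have hLU : IsInducedFrom ρ L U := hLU
  have hcard : ∀ U' : Submodule (ZMod p) U, Nat.card (U'.map U.subtype) = Nat.card U' := fun U' =>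
    (Nat.card_congr (Submodule.equivMapOfInjective _ U.injective_subtype U').toEquiv).symm
  refine ⟨L, U, hLU, ⟨?_, ?_⟩, ?_⟩
  · rw [Submodule.nontrivial_iff_ne_bot]
    rintro rfl
    have := hLU.iSup_map
    simp only [Submodule.map_bot, iSup_bot] at this
    exact bot_ne_top this
  · intro U' hU'
    by_cases h0 : U' = ⊥
    · exact Or.inl h0
    · right
      have h1 : U'.map U.subtype ≠ ⊥ := by
        intro h
        apply h0
        exact Submodule.map_injective_of_injective U.injective_subtype
          (h.trans (Submodule.map_bot _).symm)
      -- The translates of a nonzero `L`-stable `U'` span `V`, so `|U| ^ [X:L] = |V| ≤ |U'| ^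
      -- [X:L]`, which forces `U' = U`.
      have h2 := card_le_of_iSup_map_eq_top (ρ := ρ) (L := L) (U := U'.map U.subtype) (by
        rintro x hx _ ⟨u, hu, rfl⟩
        exact ⟨_, hU' ⟨x, hx⟩ u hu, rfl⟩) (hρ.iSup_map_eq_top h1)
      rw [hLU.card_eq, hcard] at h2
      exact Submodule.eq_top_of_natCard_le
        ((Nat.pow_le_pow_iff_left Subgroup.index_ne_zero_of_finite).1 h2)
  · intro L' U' h'
    apply Submodule.eq_top_of_natCard_le
    rw [← hcard]
    exact hmin (_, _) (hLU.trans h')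

/-- The maps `a ↦ c * s a` on a field, with `s` an automorphism over the prime field. -/
def semilinearMaps (p : ℕ) (K : Type*) [Field K] [Algebra (ZMod p) K] : Set (K → K) :=
  Set.range fun q : K × (K ≃ₐ[ZMod p] K) => fun a => q.1 * q.2 a

/-- The primitive module inducing `ρ` is a semilinear line over `GaloisField p n`. The equality `m =
n * L.index` compares cardinalities. -/
theorem ActsIrreducibly.exists_isInducedAlong [Fact p.Prime] (hX : IsElemAGroup X) [Finite V]
    {ρ : X →* Module.End (ZMod p) V} (hρ : ActsIrreducibly ρ) {m : ℕ} (hm : Nat.card V = p ^ m) :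
    ∃ (L : Subgroup X) (n : ℕ) (ψ : L →* Function.End (GaloisField p n))
      (j : GaloisField p n →+ V), m = n * L.index ∧ IsInducedAlong ρ L ψ j ∧
        ∀ h, ψ h ∈ semilinearMaps p (GaloisField p n) := by
  have := hX.finite
  obtain ⟨L, U, h, hirr, hprim⟩ := hρ.exists_primitive
  obtain ⟨n, hUc⟩ : ∃ n, Nat.card U = p ^ n := by
    have := Module.natCard_eq_pow_finrank (K := ZMod p) (V := U)
    rw [Nat.card_zmod] at this
    exact ⟨_, this⟩
  obtain ⟨j, hj⟩ := hirr.exists_semilinear (hX.subgroup L) hprim hUc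
  let ψ : L →* Function.End (GaloisField p n) :=
    { toFun := fun x a => j.symm (restrictAction ρ L U h.stable x (j a))
      map_one' := by
        funext a
        rw [map_one]
        exact j.symm_apply_apply a
      map_mul' := fun x y => by
        funext a
        change _ = j.symm (restrictAction ρ L U h.stable x (j (j.symm _)))
        rw [map_mul, AddEquiv.apply_symm_apply]
        rfl }
  refine ⟨L, n, ψ, U.subtype.toAddMonoidHom.comp j.toAddMonoidHom, ?_, ⟨?_, ?_, ?_⟩, ?_⟩
  · have h1 := h.card_eq
    rw [hm, hUc, ← pow_mul] at h1
    exact Nat.pow_right_injective (Fact.out : p.Prime).two_le h1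
  · intro x a
    change ((j (j.symm (restrictAction ρ L U h.stable x (j a))) : U) : V) = _
    rw [AddEquiv.apply_symm_apply]
    rfl
  · rw [eq_top_iff]
    intro v _
    have hle : (⨆ x, U.map (ρ x)) ≤ AddSubgroup.toZModSubmodule p
        (AddSubgroup.closure {v | ∃ x, ∃ a : GaloisField p n,
          v = ρ x (U.subtype.toAddMonoidHom.comp j.toAddMonoidHom a)}) := by
      refine iSup_le fun x => ?_
      rintro _ ⟨u, hu, rfl⟩
      refine AddSubgroup.subset_closure ⟨x, j.symm ⟨u, hu⟩, ?_⟩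
      change _ = ρ x ((j (j.symm ⟨u, hu⟩) : U) : V)
      rw [AddEquiv.apply_symm_apply]
    exact hle (h.iSup_map ▸ Submodule.mem_top)
  · rw [h.card_eq, Nat.card_congr j.toEquiv]
  · intro x
    obtain ⟨c, s, hcs⟩ := hj x
    refine ⟨(c, s), ?_⟩
    funext a
    change _ = j.symm (restrictAction ρ L U h.stable x (j a))
    rw [hcs, AddEquiv.symm_apply_apply]

end

/-! ### Counting maximal subgroups of prime power index -/

theorem MonoidHom.ncard_le_of_rank_le {L M : Type*} [Group L] [Finite L] [Monoid M] [Finite M]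
    {r w : ℕ} (hr : Group.rank L ≤ r) (Λ : Set M) (hΛ : Λ.ncard ≤ w) :
    {ψ : L →* M | ∀ h, ψ h ∈ Λ}.ncard ≤ w ^ r := by
  obtain ⟨S, hS, hgen⟩ := Group.rank_spec L
  rcases Set.eq_empty_or_nonempty {ψ : L →* M | ∀ h, ψ h ∈ Λ} with h0 | ⟨ψ₀, hψ₀⟩
  · rw [h0, Set.ncard_empty]
    exact Nat.zero_le _
  have hw : 0 < w := lt_of_lt_of_le ((Set.ncard_pos (Set.toFinite Λ)).2 ⟨_, hψ₀ 1⟩) hΛ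
  let f : {ψ : L →* M | ∀ h, ψ h ∈ Λ} → (S → Λ) := fun ψ s => ⟨ψ.1 s, ψ.2 s⟩
  have hf : Function.Injective f := by
    intro ψ φ h
    apply Subtype.ext
    refine MonoidHom.eq_of_eqOn_dense hgen fun s hs => ?_
    exact congrArg Subtype.val (congrFun h ⟨s, hs⟩)
  have h1 := Nat.card_le_card_of_injective f hf
  rw [Nat.card_fun, Nat.card_coe_set_eq, Nat.card_coe_set_eq, Nat.card_eq_fintype_card,
    Fintype.card_coe, hS] at h1
  exact h1.trans ((Nat.pow_le_pow_left hΛ _).trans (Nat.pow_le_pow_right hw hr))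

/-- There are `p ^ n` multipliers and `n` automorphisms, and `n ≤ p ^ n`. -/
theorem ncard_semilinearMaps_le {p n : ℕ} [hp : Fact p.Prime] (hn : n ≠ 0) :
    (semilinearMaps p (GaloisField p n)).ncard ≤ (p ^ n) ^ 2 := by
  have h1 : (semilinearMaps p (GaloisField p n)).ncard ≤
      Nat.card (GaloisField p n × (GaloisField p n ≃ₐ[ZMod p] GaloisField p n)) := by
    rw [semilinearMaps, ← Nat.card_coe_set_eq]
    exact Finite.card_range_le _
  refine h1.trans ?_
  rw [Nat.card_prod, GaloisField.card p n hn, IsGalois.card_aut_eq_finrank,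
    GaloisField.finrank p hn, sq]
  exact Nat.mul_le_mul_left _ (Nat.lt_pow_self hp.out.one_lt).le

/-- A crossed homomorphism is determined by its values on generators, and it determines its zero
set. -/
theorem IsPointStabilizer.ncard_le {p : ℕ} {X V : Type*} [Group X] [Finite X] [AddCommGroup V]
    [Module (ZMod p) V] [Finite V] {d : ℕ} (hd : Group.rank X ≤ d)
    (ρ : X →* Module.End (ZMod p) V) :
    {K : Subgroup X | ∃ δ, IsPointStabilizer ρ δ K}.ncard ≤ Nat.card V ^ d := by
  obtain ⟨S, hS, hgen⟩ := Group.rank_spec X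
  choose δ hδ using fun K : {K : Subgroup X | ∃ δ, IsPointStabilizer ρ δ K} => K.2
  let f : {K : Subgroup X | ∃ δ, IsPointStabilizer ρ δ K} → (S → V) := fun K s => δ K s
  have hone : ∀ K, δ K 1 = 0 := fun K => by
    have := (hδ K).map_mul 1 1
    rw [mul_one, map_one, Module.End.one_apply] at this
    exact left_eq_add.1 this
  have hinv : ∀ K x, ρ x (δ K x⁻¹) = - δ K x := fun K x => by
    have := (hδ K).map_mul x x⁻¹
    rw [mul_inv_cancel, hone] at this
    exact (neg_eq_of_add_eq_zero_right this.symm).symm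
  have hf : Function.Injective f := by
    intro K K' h
    let T : Subgroup X :=
      { carrier := {x | δ K x = δ K' x}
        one_mem' := by
          change δ K 1 = δ K' 1
          rw [hone, hone]
        mul_mem' := fun {a b} ha hb => by
          change δ K (a * b) = δ K' (a * b)
          change δ K a = δ K' a at ha
          change δ K b = δ K' b at hb
          rw [(hδ K).map_mul, (hδ K').map_mul, ha, hb]
        inv_mem' := fun {a} ha => by
          change δ K a⁻¹ = δ K' a⁻¹
          change δ K a = δ K' a at ha
          have h1 : ρ a (δ K a⁻¹) = ρ a (δ K' a⁻¹) := by rw [hinv, hinv, ha]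
          have h2 := congrArg (ρ a⁻¹) h1
          rwa [MonoidHom.end_inv_apply, MonoidHom.end_inv_apply] at h2 }
    have hT : T = ⊤ := by
      rw [eq_top_iff, ← hgen, Subgroup.closure_le]
      intro s hs
      exact congrFun h ⟨s, hs⟩
    apply Subtype.ext
    ext x
    have hx : x ∈ T := hT ▸ Subgroup.mem_top x
    rw [(hδ K).mem_iff, (hδ K').mem_iff, show δ K x = δ K' x from hx]
  have h1 := Nat.card_le_card_of_injective f hf
  rw [Nat.card_fun, Nat.card_coe_set_eq, Nat.card_eq_fintype_card (α := S), Fintype.card_coe, hS]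
    at h1
  exact h1.trans (Nat.pow_le_pow_right Nat.card_pos hd)

/-- Maximal subgroups of index `p ^ m` are bounded in terms of all subgroups of index at most
`m`. -/
theorem IsElemAGroup.ncard_isCoatom_le {X : Type*} [Group X] (hX : IsElemAGroup X) [Finite X]
    {d p m : ℕ} (hd : Group.rank X ≤ d) (hp : p.Prime) (hm : m ≠ 0) :
    {K : Subgroup X | IsCoatom K ∧ K.index = p ^ m}.ncard ≤
      (p ^ m) ^ (3 * d) * ∑ t ∈ Finset.Icc 1 m, {L : Subgroup X | L.index = t}.ncard := by
  classical
  have := Fact.mk hp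
  let V := Fin m → ZMod p
  have hV : Nat.card V = p ^ m := by
    rw [Nat.card_fun, Nat.card_zmod, Nat.card_eq_fintype_card, Fintype.card_fin]
  have hex : ∀ K : {K : Subgroup X | IsCoatom K ∧ K.index = p ^ m},
      ∃ (ρ : X →* Module.End (ZMod p) V) (δ : X → V),
        ActsIrreducibly ρ ∧ IsPointStabilizer ρ δ K := by
    rintro ⟨K, hK, hidx⟩
    obtain ⟨q, n, hq, hqn, h⟩ := hX.exists_isPointStabilizer hK
    have hn : n ≠ 0 := by
      rintro rfl
      rw [hidx, pow_zero] at hqn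
      exact hm ((Nat.pow_eq_one.1 hqn).resolve_left hp.one_lt.ne')
    have hqn' : p ^ m = q ^ n := hidx.symm.trans hqn
    have hpq : p = q := (Nat.prime_dvd_prime_iff_eq hp hq).1
      (hp.dvd_of_dvd_pow (hqn' ▸ dvd_pow_self p hm))
    subst hpq
    have hmn : m = n := Nat.pow_right_injective hp.two_le hqn'
    subst hmn
    exact h
  choose ρ δ hirr hst using hex
  choose L n ψ j hmL hind hsl using fun K => (hirr K).exists_isInducedAlong hX hV
  -- The inducing data of the module attached to `K`. Subgroups with equal data have isomorphic
  -- modules, so each fibre of `F` consists of point stabilizers for a single `ρ K₀`.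
  let D := Σ q : {q : Subgroup X × ℕ // m = q.2 * q.1.index},
    {ψ : q.1.1 →* Function.End (GaloisField p q.1.2) | ∀ h, ψ h ∈ semilinearMaps p _}
  let F : {K : Subgroup X | IsCoatom K ∧ K.index = p ^ m} → D := fun K =>
    ⟨⟨(L K, n K), hmL K⟩, ⟨ψ K, hsl K⟩⟩
  have hidx0 : ∀ q : {q : Subgroup X × ℕ // m = q.2 * q.1.index}, q.1.2 ≠ 0 := by
    rintro ⟨⟨L, n⟩, h⟩ (rfl : n = 0)
    exact hm (by simpa using h)
  have : Finite {q : Subgroup X × ℕ // m = q.2 * q.1.index} := by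
    refine Finite.of_injective (fun q => q.1.1) ?_
    rintro ⟨⟨L, n⟩, h⟩ ⟨⟨L', n'⟩, h'⟩ (rfl : L = L')
    have : n = n' := Nat.eq_of_mul_eq_mul_right (Nat.pos_of_ne_zero Subgroup.index_ne_zero_of_finite)
      (h.symm.trans h')
    subst this
    rfl
  have hEnd : ∀ k, Finite (Function.End (GaloisField p k)) := fun k =>
    inferInstanceAs (Finite (GaloisField p k → GaloisField p k))
  have hHom : ∀ (L : Subgroup X) k, Finite (L →* Function.End (GaloisField p k)) := fun L k =>
    DFunLike.finite _
  have hfib : ∀ b : D, Nat.card {K // F K = b} ≤ (p ^ m) ^ d := by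
    intro b
    rcases isEmpty_or_nonempty {K // F K = b} with h0 | ⟨⟨K₀, hK₀⟩⟩
    · rw [Nat.card_of_isEmpty]
      exact Nat.zero_le _
    refine le_trans ?_ ((IsPointStabilizer.ncard_le hd (ρ K₀)).trans (by rw [hV]))
    rw [← Nat.card_coe_set_eq]
    refine Nat.card_le_card_of_injective (fun K => ⟨K.1.1, ?_⟩) ?_
    · obtain ⟨K, hK⟩ := K
      have hFK : F K = F K₀ := hK.trans hK₀.symm
      obtain ⟨φ, hφ⟩ : ∃ φ : V ≃+ V, ∀ x v, φ (ρ K x v) = ρ K₀ x (φ v) := by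
        have key : ∀ b c : D, b = c → ∀ (ρ ρ' : X →* Module.End (ZMod p) V)
            (j : GaloisField p b.1.1.2 →+ V) (j' : GaloisField p c.1.1.2 →+ V),
            IsInducedAlong ρ b.1.1.1 b.2.1 j → IsInducedAlong ρ' c.1.1.1 c.2.1 j' →
            ∃ φ : V ≃+ V, ∀ x v, φ (ρ x v) = ρ' x (φ v) := by
          rintro b _ rfl ρ ρ' j j' h h'
          exact h.exists_equiv h'
        exact key _ _ hFK (ρ K) (ρ K₀) (j K) (j K₀) (hind K) (hind K₀)
      refine ⟨fun x => φ (δ K x), ?_, ?_⟩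
      · intro x y
        rw [(hst K).map_mul, map_add, hφ]
      · intro x
        rw [(hst K).mem_iff, map_eq_zero_iff φ φ.injective]
    · intro K K' h
      exact Subtype.ext (Subtype.ext (congrArg (fun z => z.1) h))
  have hDcard : Nat.card D ≤ (p ^ m) ^ (2 * d) *
      Nat.card {q : Subgroup X × ℕ // m = q.2 * q.1.index} := by
    have := Fintype.ofFinite {q : Subgroup X × ℕ // m = q.2 * q.1.index}
    rw [Nat.card_sigma]
    refine (Finset.sum_le_card_nsmul _ _ ((p ^ m) ^ (2 * d)) ?_).trans ?_
    · rintro ⟨⟨L, n⟩, h⟩ -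
      rw [Nat.card_coe_set_eq]
      -- With `(p ^ n) ^ 2` choices per generator this gives `p ^ (2n [X:L] d) = p ^ (2md)` actions,
      -- independently of `L`.
      have hr : Group.rank L ≤ L.index * d :=
        L.rank_le_index_mul_rank.trans (Nat.mul_le_mul_left _ hd)
      refine (MonoidHom.ncard_le_of_rank_le (M := Function.End (GaloisField p n)) hr _
        (ncard_semilinearMaps_le (hidx0 ⟨⟨L, n⟩, h⟩))).trans ?_
      dsimp only at h
      rw [h, ← pow_mul, ← pow_mul, ← pow_mul]
      exact le_of_eq (congrArg _ (by ring))
    · rw [smul_eq_mul, Finset.card_univ, Nat.card_eq_fintype_card, mul_comm]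
  have hQcard : Nat.card {q : Subgroup X × ℕ // m = q.2 * q.1.index} ≤
      ∑ t ∈ Finset.Icc 1 m, {L : Subgroup X | L.index = t}.ncard := by
    let g : {q : Subgroup X × ℕ // m = q.2 * q.1.index} →
        Σ t : Finset.Icc 1 m, {L : Subgroup X | L.index = t} := fun q =>
      ⟨⟨q.1.1.index, Finset.mem_Icc.2 ⟨Nat.pos_of_ne_zero Subgroup.index_ne_zero_of_finite,
        Nat.le_of_dvd (Nat.pos_of_ne_zero hm) ⟨q.1.2, by rw [mul_comm]; exact q.2⟩⟩⟩, ⟨q.1.1, rfl⟩⟩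
    have hg : Function.Injective g := by
      rintro ⟨⟨L, n⟩, h⟩ ⟨⟨L', n'⟩, h'⟩ hq
      have hL : L = L' := congrArg (fun z => (z.2 : Subgroup X)) hq
      subst hL
      have : n = n' := Nat.eq_of_mul_eq_mul_right
        (Nat.pos_of_ne_zero Subgroup.index_ne_zero_of_finite) (h.symm.trans h')
      subst this
      rfl
    refine (Nat.card_le_card_of_injective g hg).trans ?_
    rw [Nat.card_sigma, ← Finset.sum_coe_sort (Finset.Icc 1 m)]
    exact le_of_eq rfl
  have hfinal : Nat.card {K : Subgroup X | IsCoatom K ∧ K.index = p ^ m} ≤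
      Nat.card D * (p ^ m) ^ d := by
    have := Fintype.ofFinite D
    rw [Nat.card_congr (Equiv.sigmaFiberEquiv F).symm, Nat.card_sigma]
    refine (Finset.sum_le_card_nsmul _ _ _ fun b _ => hfib b).trans ?_
    rw [smul_eq_mul, Finset.card_univ, Nat.card_eq_fintype_card]
  rw [← Nat.card_coe_set_eq]
  calc _ ≤ _ := hfinal
    _ ≤ ((p ^ m) ^ (2 * d) * ∑ t ∈ Finset.Icc 1 m, {L : Subgroup X | L.index = t}.ncard) *
        (p ^ m) ^ d := Nat.mul_le_mul_right _ (hDcard.trans (Nat.mul_le_mul_left _ hQcard))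
    _ = _ := by ring

theorem Set.ncard_le_sum_mul_of_cover {α β : Type*} [Finite α] [Finite β] {s : Set α}
    (I : Finset ℕ) (T : ℕ → Set β) (B : ℕ → β → Set α) (u v : ℕ → ℕ)
    (hs : ∀ x ∈ s, ∃ n ∈ I, ∃ k ∈ T n, x ∈ B n k) (hT : ∀ n ∈ I, (T n).ncard ≤ u n)
    (hB : ∀ n ∈ I, ∀ k ∈ T n, (B n k).ncard ≤ v n) : s.ncard ≤ ∑ n ∈ I, u n * v n := by
  classical
  have := Fintype.ofFinite α
  have := Fintype.ofFinite β
  have h1 : s ⊆ ((I.biUnion fun n => (T n).toFinset.biUnion fun k => (B n k).toFinset :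
      Finset α) : Set α) := by
    intro x hx
    obtain ⟨n, hn, k, hk, hxk⟩ := hs x hx
    simp only [Finset.coe_biUnion, Set.mem_iUnion, Finset.mem_coe, Set.mem_toFinset]
    exact ⟨n, hn, k, by simpa using hk, by simpa using hxk⟩
  refine (Set.ncard_le_ncard h1 (Finset.finite_toSet _)).trans ?_
  rw [Set.ncard_coe_finset]
  refine Finset.card_biUnion_le.trans (Finset.sum_le_sum fun n hn => ?_)
  refine (Finset.card_biUnion_le_card_mul _ _ (v n) fun k hk => ?_).trans ?_
  · rw [← Set.ncard_eq_toFinset_card']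
    exact hB n hn k (by simpa using hk)
  · rw [← Set.ncard_eq_toFinset_card']
    exact Nat.mul_le_mul_right _ (hT n hn)

/-! ### Numerical estimates -/

theorem Nat.pow_nine_le {n : ℕ} (hn : 2 ≤ n) : n ^ 9 ≤ 32 ^ n := by
  rcases hn.eq_or_lt with rfl | hn
  · norm_num
  -- The induction starts at 3, where `((n + 1) / n) ^ 9 ≤ (4 / 3) ^ 9 < 32`; at `n = 2` this ratio
  -- exceeds 32.
  · induction n, hn using Nat.le_induction with
    | base => norm_num
    | succ n hn ih =>
      have h1 : (3 * (n + 1)) ^ 9 ≤ (4 * n) ^ 9 := Nat.pow_le_pow_left (by omega) 9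
      rw [mul_pow, mul_pow] at h1
      rw [pow_succ 32 n]
      norm_num at h1
      omega

/-- The geometric sum is at most twice its last term. With `32 ^ d * 2 ≤ 64 ^ d` this completes to
`64 ^ (dm) ≤ (p ^ m) ^ (6d)`, and `9d = 3d + 6d`. -/
theorem Nat.pow_mul_sum_le {p m d : ℕ} (hp : 2 ≤ p) (hm : m ≠ 0) (hd : d ≠ 0) :
    32 ^ d * ((p ^ m) ^ (3 * d) * ∑ s ∈ Finset.Icc 1 m, 64 ^ (d * (s - 1))) ≤
      (p ^ m) ^ (9 * d) := by
  have hsum : ∀ k : ℕ, ∑ s ∈ Finset.Icc 1 (k + 1), 64 ^ (d * (s - 1)) ≤ 2 * 64 ^ (d * k) := by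
    intro k
    induction k with
    | zero => simp
    | succ k ih =>
      rw [Finset.sum_Icc_succ_top (by omega), Nat.add_sub_cancel]
      have h1 : 2 * 64 ^ (d * k) ≤ 64 ^ (d * (k + 1)) := by
        rw [mul_add, pow_add, mul_comm]
        refine Nat.mul_le_mul_left _ ?_
        rw [mul_one]
        exact (by norm_num : 2 ≤ 64 ^ 1).trans (Nat.pow_le_pow_right (by norm_num) (by omega))
      omega
  obtain ⟨k, rfl⟩ := Nat.exists_eq_succ_of_ne_zero hm
  have h2 : 32 ^ d * 2 ≤ 64 ^ d := by
    have : (64 : ℕ) ^ d = 32 ^ d * 2 ^ d := by rw [← mul_pow]; norm_num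
    rw [this]
    refine Nat.mul_le_mul_left _ ?_
    exact (by norm_num : 2 ≤ 2 ^ 1).trans (Nat.pow_le_pow_right (by norm_num) (by omega))
  have h3 : 64 ^ (d * (k + 1)) ≤ (p ^ (k + 1)) ^ (6 * d) := by
    have : (64 : ℕ) ^ (d * (k + 1)) = (2 ^ (k + 1)) ^ (6 * d) := by
      rw [show (64 : ℕ) = 2 ^ 6 by norm_num, ← pow_mul, ← pow_mul]
      congr 1
      ring
    rw [this]
    exact Nat.pow_le_pow_left (Nat.pow_le_pow_left hp _) _
  calc 32 ^ d * ((p ^ (k + 1)) ^ (3 * d) * ∑ s ∈ Finset.Icc 1 (k + 1), 64 ^ (d * (s - 1)))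
      ≤ 32 ^ d * ((p ^ (k + 1)) ^ (3 * d) * (2 * 64 ^ (d * k))) := by gcongr; exact hsum k
    _ = (p ^ (k + 1)) ^ (3 * d) * ((32 ^ d * 2) * 64 ^ (d * k)) := by ring
    _ ≤ (p ^ (k + 1)) ^ (3 * d) * (64 ^ d * 64 ^ (d * k)) := by gcongr
    _ = (p ^ (k + 1)) ^ (3 * d) * 64 ^ (d * (k + 1)) := by
        rw [← pow_add]
        congr 2
        ring
    _ ≤ (p ^ (k + 1)) ^ (3 * d) * (p ^ (k + 1)) ^ (6 * d) := by gcongr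
    _ = (p ^ (k + 1)) ^ (9 * d) := by rw [← pow_add]; congr 1; ring

/-- Geometric series: the partial sum up to `k + 1` is at most `A (1 - 2 ^ (-k))`, written without
subtraction. -/
theorem Finset.sum_Icc_le_of_mul_two_pow_le {a : ℕ → ℕ} {A : ℕ} (t : ℕ)
    (h : ∀ n ∈ Finset.Icc 2 t, a n * 2 ^ (n - 1) ≤ A) : ∑ n ∈ Finset.Icc 2 t, a n ≤ A := by
  have key : ∀ k, k + 1 ≤ t →
      (∑ n ∈ Finset.Icc 2 (k + 1), a n) * 2 ^ k + A ≤ A * 2 ^ k := by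
    intro k
    induction k with
    | zero => simp
    | succ k ih =>
      intro hk
      have h1 := ih (by omega)
      have h2 := h (k + 2) (Finset.mem_Icc.2 ⟨by omega, hk⟩)
      rw [Finset.sum_Icc_succ_top (by omega)]
      rw [show k + 2 - 1 = k + 1 by omega] at h2
      rw [add_mul, show k + 1 + 1 = k + 2 by ring, pow_succ] at *
      nlinarith
  rcases t with _ | t
  · simp
  · have := key t le_rfl
    exact Nat.le_of_mul_le_mul_right (le_of_add_le_left this) (by positivity)

/-- Telescoping via `1 / n ^ 2 ≤ 1 / (n - 1) - 1 / n`: the partial sum up to `k + 1` is at most `A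
(1 - 1 / (k + 1))`. -/
theorem Finset.sum_Icc_le_of_mul_sq_le {a : ℕ → ℕ} {A : ℕ} (t : ℕ)
    (h : ∀ n ∈ Finset.Icc 2 t, a n * n ^ 2 ≤ A) : ∑ n ∈ Finset.Icc 2 t, a n ≤ A := by
  have key : ∀ k, k + 1 ≤ t →
      (∑ n ∈ Finset.Icc 2 (k + 1), a n) * (k + 1) + A ≤ A * (k + 1) := by
    intro k
    induction k with
    | zero => simp
    | succ k ih =>
      intro hk
      have h1 := ih (by omega)
      have h2 := h (k + 2) (Finset.mem_Icc.2 ⟨by omega, hk⟩)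
      rw [Finset.sum_Icc_succ_top (by omega)]
      set s := ∑ n ∈ Finset.Icc 2 (k + 1), a n
      have h3 : (k + 1) * (((s + a (k + 1 + 1)) * (k + 1 + 1)) + A) ≤
          (k + 1) * (A * (k + 1 + 1)) := by
        have h4 := Nat.mul_le_mul_right (k + 2) h1
        have h5 : (k + 1) * (a (k + 2) * (k + 2)) ≤ a (k + 2) * (k + 2) ^ 2 := by
          have : (k + 1) * (a (k + 2) * (k + 2)) + a (k + 2) * (k + 2) =
            a (k + 2) * (k + 2) ^ 2 := by ring
          omega
        have h6 := h5.trans h2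
        ring_nf at h4 h6 ⊢
        omega
      exact Nat.le_of_mul_le_mul_left h3 (by omega)
  rcases t with _ | t
  · simp
  · have := key t le_rfl
    exact Nat.le_of_mul_le_mul_right (le_of_add_le_left this) (by positivity)

/-! ### Growth of all, maximal and normal subgroups -/

/-- The inductive link: for `n = p ^ m` only subgroups of index at most `m < n` enter. The factor
`32 ^ d` later turns `32 ^ (dn)` into `32 ^ (d(n-1))`. -/
theorem IsElemAGroup.ncard_isCoatom_le_of_subgroups {X : Type*} [Group X] (hX : IsElemAGroup X)
    [Finite X] {d n : ℕ} (hd : Group.rank X ≤ d) (hd0 : d ≠ 0) (hn : 2 ≤ n)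
    (hsub : ∀ t, 1 ≤ t → t < n → {L : Subgroup X | L.index = t}.ncard ≤ 64 ^ (d * (t - 1))) :
    32 ^ d * {K : Subgroup X | IsCoatom K ∧ K.index = n}.ncard ≤ n ^ (9 * d) := by
  rcases Set.eq_empty_or_nonempty {K : Subgroup X | IsCoatom K ∧ K.index = n} with h0 | ⟨K, hK, h⟩
  · rw [h0, Set.ncard_empty]
    simp
  · obtain ⟨p, m, hp, hpm, -⟩ := hX.exists_isPointStabilizer hK
    obtain rfl : n = p ^ m := h.symm.trans hpm
    have hm : m ≠ 0 := by
      rintro rfl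
      simp at hn
    refine le_trans (Nat.mul_le_mul_left _ ?_) (Nat.pow_mul_sum_le hp.two_le hm hd0)
    refine (hX.ncard_isCoatom_le hd hp hm).trans (Nat.mul_le_mul_left _ ?_)
    refine Finset.sum_le_sum fun t ht => ?_
    rw [Finset.mem_Icc] at ht
    exact hsub t ht.1 (ht.2.trans_lt (Nat.lt_pow_self hp.one_lt))

/-- Subgroup growth of a group in `IsElemAGroup` is at most exponential. -/
theorem IsElemAGroup.ncard_index_eq_le {X : Type*} [Group X] (hX : IsElemAGroup X) [Finite X]
    {d : ℕ} (hd : Group.rank X ≤ d) (hd0 : d ≠ 0) {t : ℕ} (ht : 1 ≤ t) :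
    {L : Subgroup X | L.index = t}.ncard ≤ 64 ^ (d * (t - 1)) := by
  -- The induction passes to a maximal subgroup `K` of index `n`, whose rank is at most `n * d`.
  -- Inside it the bound is `64 ^ (nd(t/n - 1)) = 64 ^ (d(t - n))`.
  induction t using Nat.strong_induction_on generalizing X d with
  | _ t ih =>
    rcases ht.eq_or_lt with rfl | ht
    · have : {L : Subgroup X | L.index = 1} = {⊤} := by
        ext L
        simp [Subgroup.index_eq_one]
      rw [this, Set.ncard_singleton]
      simp
    · refine (Set.ncard_le_sum_mul_of_cover (Finset.Icc 2 t)
        (fun n => {K : Subgroup X | IsCoatom K ∧ K.index = n})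
        (fun n K => {L | L.index = t ∧ L ≤ K}) (fun n => 32 ^ (d * (n - 1)))
        (fun n => 64 ^ (d * (t - n))) ?_ ?_ ?_).trans ?_
      · intro L (hL : L.index = t)
        have hLt : L ≠ ⊤ := by
          rintro rfl
          rw [Subgroup.index_top] at hL
          omega
        obtain ⟨K, hK, hLK⟩ := (eq_top_or_exists_le_coatom L).resolve_left hLt
        refine ⟨K.index, ?_, K, ⟨hK, rfl⟩, hL, hLK⟩
        have h1 : K.index ≠ 1 := fun h => hK.1 (Subgroup.index_eq_one.1 h)
        have h2 : K.index ≠ 0 := Subgroup.index_ne_zero_of_finite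
        have h3 := Nat.le_of_dvd (by omega) (hL ▸ Subgroup.index_dvd_of_le hLK)
        rw [Finset.mem_Icc]
        omega
      · intro n hn
        rw [Finset.mem_Icc] at hn
        have h1 := hX.ncard_isCoatom_le_of_subgroups hd hd0 hn.1
          (fun s hs hsn => ih s (hsn.trans_le hn.2) hX hd hd0 hs)
        have h2 : n ^ (9 * d) ≤ 32 ^ d * 32 ^ (d * (n - 1)) := by
          calc n ^ (9 * d) = (n ^ 9) ^ d := by rw [pow_mul]
            _ ≤ (32 ^ n) ^ d := Nat.pow_le_pow_left (Nat.pow_nine_le hn.1) _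
            _ = 32 ^ d * 32 ^ (d * (n - 1)) := by
              rw [← pow_mul, ← pow_add]
              congr 1
              obtain ⟨k, rfl⟩ : ∃ k, n = k + 1 := ⟨n - 1, by omega⟩
              rw [Nat.add_sub_cancel]
              ring
        exact Nat.le_of_mul_le_mul_left (h1.trans h2) (by positivity)
      · rintro n hn K ⟨hK, hKn⟩
        rw [Finset.mem_Icc] at hn
        by_cases hnt : n ∣ t
        · obtain ⟨r, rfl⟩ := hnt
          have hr : 1 ≤ r := by
            rcases r with _ | r
            · omega
            · omega
          have hrn : r < n * r := by nlinarith
          have hrank : Group.rank K ≤ n * d := by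
            have := K.rank_le_index_mul_rank
            rw [hKn] at this
            exact this.trans (Nat.mul_le_mul_left _ hd)
          have h1 := ih r hrn (hX.subgroup K) hrank (Nat.mul_ne_zero (by omega) hd0) hr
          have e : n * d * (r - 1) = d * (n * r - n) := by
            obtain ⟨k, rfl⟩ : ∃ k, r = k + 1 := ⟨r - 1, by omega⟩
            rw [Nat.add_sub_cancel, mul_add, mul_one, Nat.add_sub_cancel]
            ring
          rw [e] at h1
          refine le_trans ?_ h1
          refine Set.ncard_le_ncard_of_injOn (fun L => L.subgroupOf K) ?_ ?_ (Set.toFinite _)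
          · rintro L ⟨hL, hLK⟩
            have h2 := Subgroup.relIndex_mul_index hLK
            rw [hL, hKn, mul_comm] at h2
            exact Nat.eq_of_mul_eq_mul_left (by omega) h2
          · rintro L ⟨-, hLK⟩ L' ⟨-, hLK'⟩ h
            have h3 := Subgroup.subgroupOf_inj.1 h
            rwa [inf_eq_left.2 hLK, inf_eq_left.2 hLK'] at h3
        · have : {L : Subgroup X | L.index = t ∧ L ≤ K} = ∅ := by
            rw [Set.eq_empty_iff_forall_notMem]
            rintro L ⟨hL, hLK⟩
            exact hnt (hKn ▸ hL ▸ Subgroup.index_dvd_of_le hLK)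
          rw [this, Set.ncard_empty]
          exact Nat.zero_le _
      -- The gap between 32 and 64 supplies the geometric weight `2 ^ (n - 1)`.
      · refine Finset.sum_Icc_le_of_mul_two_pow_le t fun n hn => ?_
        rw [Finset.mem_Icc] at hn
        have h1 : 32 ^ (d * (n - 1)) * 2 ^ (n - 1) ≤ 64 ^ (d * (n - 1)) := by
          calc 32 ^ (d * (n - 1)) * 2 ^ (n - 1) ≤ 32 ^ (d * (n - 1)) * 2 ^ (d * (n - 1)) := by
                refine Nat.mul_le_mul_left _ (Nat.pow_le_pow_right (by norm_num) ?_)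
                exact Nat.le_mul_of_pos_left _ (Nat.pos_of_ne_zero hd0)
            _ = 64 ^ (d * (n - 1)) := by rw [← mul_pow]; norm_num
        calc 32 ^ (d * (n - 1)) * 64 ^ (d * (t - n)) * 2 ^ (n - 1)
            = (32 ^ (d * (n - 1)) * 2 ^ (n - 1)) * 64 ^ (d * (t - n)) := by ring
          _ ≤ 64 ^ (d * (n - 1)) * 64 ^ (d * (t - n)) := Nat.mul_le_mul_right _ h1
          _ = 64 ^ (d * (t - 1)) := by
            rw [← pow_add, ← mul_add]
            congr 2
            omega

theorem IsElemAGroup.ncard_isCoatom_le_pow {X : Type*} [Group X] (hX : IsElemAGroup X) [Finite X]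
    {d n : ℕ} (hd : Group.rank X ≤ d) (hd0 : d ≠ 0) (hn : 2 ≤ n) :
    {K : Subgroup X | IsCoatom K ∧ K.index = n}.ncard ≤ n ^ (9 * d) :=
  (Nat.le_mul_of_pos_left _ (by positivity)).trans
    (hX.ncard_isCoatom_le_of_subgroups hd hd0 hn fun _ ht _ => hX.ncard_index_eq_le hd hd0 ht)

/-- Normal subgroup growth of a group in `IsElemAGroup` is polynomial, with degree depending only
on the number of generators. -/
theorem IsElemAGroup.ncard_normal_le {X : Type*} [Group X] (hX : IsElemAGroup X) [Finite X]
    {d : ℕ} (hd : Group.rank X ≤ d) (hd0 : d ≠ 0) {k : ℕ} (hk : 1 ≤ k) :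
    {N : Subgroup X | N.Normal ∧ N.index = k}.ncard ≤ k ^ (9 * d + 2) := by
  induction k using Nat.strong_induction_on with
  | _ k ih =>
    rcases hk.eq_or_lt with rfl | hk
    · have : {N : Subgroup X | N.Normal ∧ N.index = 1} ⊆ {⊤} := by
        rintro N ⟨-, hN⟩
        exact Subgroup.index_eq_one.1 hN
      refine (Set.ncard_le_ncard this).trans ?_
      rw [Set.ncard_singleton, one_pow]
    · refine (Set.ncard_le_sum_mul_of_cover (Finset.Icc 2 k)
        (fun n => {K : Subgroup X | IsCoatom K ∧ K.index = n})
        (fun n K => {N | ∃ L : Subgroup X, L.Normal ∧ N = L ⊓ K ∧ k = L.index * n})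
        (fun n => n ^ (9 * d))
        (fun n => (k / n) ^ (9 * d + 2)) ?_ ?_ ?_).trans ?_
      · rintro N ⟨hN, hNk⟩
        have hNt : N ≠ ⊤ := by
          rintro rfl
          rw [Subgroup.index_top] at hNk
          omega
        obtain ⟨L, K, hL, hK, hLK, hidx⟩ := hX.normal_eq_inf_coatom N hNt
        refine ⟨K.index, ?_, K, ⟨hK, rfl⟩, L, hL, hLK, hNk.symm.trans hidx⟩
        have h1 : K.index ≠ 1 := fun h => hK.1 (Subgroup.index_eq_one.1 h)
        have h2 : K.index ≠ 0 := Subgroup.index_ne_zero_of_finite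
        have h3 := Nat.le_of_dvd (by omega) (⟨L.index, by
          rw [mul_comm, ← hidx, hNk]⟩ : K.index ∣ k)
        rw [Finset.mem_Icc]
        omega
      · intro n hn
        rw [Finset.mem_Icc] at hn
        exact hX.ncard_isCoatom_le_pow hd hd0 hn.1
      · rintro n hn K -
        rw [Finset.mem_Icc] at hn
        by_cases hnk : n ∣ k
        · obtain ⟨r, rfl⟩ := hnk
          have hr : 1 ≤ r := by
            rcases r with _ | r
            · omega
            · omega
          have hrn : r < n * r := by nlinarith
          rw [Nat.mul_div_cancel_left _ (by omega)]
          refine le_trans ?_ (ih r hrn hr)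
          refine (Set.ncard_le_ncard (t := (fun L => L ⊓ K) ''
            {N : Subgroup X | N.Normal ∧ N.index = r}) ?_ (Set.toFinite _)).trans
            (Set.ncard_image_le (Set.toFinite _))
          rintro N ⟨L, hL, hN, h⟩
          rw [mul_comm] at h
          exact ⟨L, ⟨hL, (Nat.eq_of_mul_eq_mul_right (by omega) h).symm⟩, hN.symm⟩
        · have : {N | ∃ L : Subgroup X, L.Normal ∧ N = L ⊓ K ∧ k = L.index * n} = ∅ := by
            rw [Set.eq_empty_iff_forall_notMem]
            rintro N ⟨L, -, -, h⟩
            exact hnk ⟨L.index, by rw [mul_comm]; exact h⟩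
          rw [this, Set.ncard_empty]
          exact Nat.zero_le _
      -- The `+ 2` in the exponent leaves the factor `n ^ 2` that makes the sum over `n` converge.
      · refine Finset.sum_Icc_le_of_mul_sq_le k fun n hn => ?_
        calc n ^ (9 * d) * (k / n) ^ (9 * d + 2) * n ^ 2 = (k / n * n) ^ (9 * d + 2) := by
              rw [mul_pow, pow_add n]
              ring
          _ ≤ k ^ (9 * d + 2) := Nat.pow_le_pow_left (Nat.div_mul_le_self k n) _

/-! ### Finite quotients of graded profinite groups -/

/-- A `q`-element of `S l` drops to `S (l + 1)` unless `q = P l`. By injectivity this fails for at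
most one index `j`, so a `q`-subgroup lies in `S j` and meets `S (j + 1)` trivially: it embeds in
one elementary abelian layer, or is trivial if `q` does not occur. -/
theorem IsElemAGroup.of_series {X : Type*} [Group X] [Finite X] {P : ℕ → ℕ}
    (hP : ∀ i, (P i).Prime) (hinj : Function.Injective P) (S : ℕ → Subgroup X) (h0 : S 0 = ⊤)
    (hanti : Antitone S) {n : ℕ} (hn : S n = ⊥) (hcomm : ∀ l, ⁅S l, S l⁆ ≤ S (l + 1))
    (hpow : ∀ l, ∀ x ∈ S l, x ^ P l ∈ S (l + 1)) : IsElemAGroup X := by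
  have hstep : ∀ q : ℕ, q.Prime → ∀ l, q ≠ P l → ∀ x ∈ S l, (∃ k, x ^ q ^ k = 1) →
      x ∈ S (l + 1) := by
    rintro q hq l hql x hx ⟨k, hk⟩
    have hcop : (q ^ k).Coprime (P l) := ((Nat.coprime_primes hq (hP l)).2 hql).pow_left k
    have h1 : x ^ q ^ k ∈ S (l + 1) := hk ▸ one_mem _
    have h2 := Nat.gcd_eq_gcd_ab (q ^ k) (P l)
    rw [hcop.gcd_eq_one] at h2
    have e : x = (x ^ q ^ k) ^ Nat.gcdA (q ^ k) (P l) * (x ^ P l) ^ Nat.gcdB (q ^ k) (P l) := by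
      rw [← zpow_natCast, ← zpow_natCast, ← zpow_mul, ← zpow_mul, ← zpow_add, ← h2]
      simp
    rw [e]
    exact mul_mem (zpow_mem h1 _) (zpow_mem (hpow l x hx) _)
  have hrange : ∀ q : ℕ, q.Prime → ∀ l, (∀ i, l ≤ i → q ≠ P i) → ∀ x ∈ S l,
      (∃ k, x ^ q ^ k = 1) → x = 1 := by
    intro q hq l hl x hx hk
    have h1 : ∀ i, x ∈ S (l + i) := by
      intro i
      induction i with
      | zero => exact hx
      | succ i ih => exact hstep q hq _ (hl _ (Nat.le_add_right l i)) x ih hk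
    have h2 := hanti (Nat.le_add_left n l) (h1 n)
    rwa [hn, Subgroup.mem_bot] at h2
  have hmain : ∀ q : ℕ, q.Prime → ∀ Q : Subgroup X, IsPGroup q Q → ∀ x ∈ Q,
      x ^ q = 1 ∧ ∀ y ∈ Q, x * y = y * x := by
    intro q hq Q hQ x hx
    have hQ' : ∀ x ∈ Q, ∃ k, x ^ q ^ k = 1 := by
      intro x hx
      obtain ⟨k, hk⟩ := hQ ⟨x, hx⟩
      exact ⟨k, by simpa using congrArg Subtype.val hk⟩
    by_cases hj : ∃ j, q = P j
    · obtain ⟨j, rfl⟩ := hj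
      have hall : ∀ i ≤ j, ∀ x ∈ Q, x ∈ S i := by
        intro i
        induction i with
        | zero =>
          intro _ x _
          rw [h0]
          exact Subgroup.mem_top x
        | succ i ih =>
          intro hi x hx
          exact hstep _ hq i (fun h => by have := hinj h; omega) x (ih (by omega) x hx) (hQ' x hx)
      have hne : ∀ i, j + 1 ≤ i → P j ≠ P i := fun i hi h => by
        have := hinj h
        omega
      refine ⟨hrange _ hq (j + 1) hne _ (hpow j x (hall j le_rfl x hx))
        (hQ' _ (pow_mem hx _)), fun y hy => ?_⟩
      rw [← commutatorElement_eq_one_iff_mul_comm]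
      refine hrange _ hq (j + 1) hne _ (hcomm j (Subgroup.commutator_mem_commutator
        (hall j le_rfl x hx) (hall j le_rfl y hy))) (hQ' _ ?_)
      exact mul_mem (mul_mem (mul_mem hx hy) (inv_mem hx)) (inv_mem hy)
    · have htriv : ∀ x ∈ Q, x = 1 := fun x hx =>
        hrange q hq 0 (fun i _ h => hj ⟨i, h⟩) x (h0 ▸ Subgroup.mem_top x) (hQ' x hx)
      rw [htriv x hx]
      exact ⟨one_pow _, fun y _ => by simp⟩
  refine ⟨inferInstance, ?_, fun q hq Q hQ x hx => (hmain q hq Q hQ x hx).2,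
    fun q hq Q hQ x hx => (hmain q hq Q hQ x hx).1⟩
  have hder : ∀ l, derivedSeries X l ≤ S l := by
    intro l
    induction l with
    | zero =>
      rw [h0]
      exact le_top
    | succ l ih =>
      rw [derivedSeries_succ]
      exact (Subgroup.commutator_mono ih ih).trans (hcomm l)
  exact ⟨n, le_bot_iff.1 (hn ▸ hder n)⟩

namespace GradedProfinite

variable {G : Type*} [Group G] [TopologicalSpace G] [IsTopologicalGroup G]

theorem isClosed_gradedSeries (P : ℕ → ℕ) (n : ℕ) :
    IsClosed (gradedSeries G P n : Set G) := by
  cases n with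
  | zero => exact isClosed_univ
  | succ n => exact Subgroup.isClosed_topologicalClosure _

theorem commutator_gradedSeries_le (P : ℕ → ℕ) (n : ℕ) :
    ⁅gradedSeries G P n, gradedSeries G P n⁆ ≤ gradedSeries G P (n + 1) :=
  le_sup_left.trans (Subgroup.le_topologicalClosure _)

theorem pow_mem_gradedSeries (P : ℕ → ℕ) (n : ℕ) {x : G} (hx : x ∈ gradedSeries G P n) :
    x ^ P n ∈ gradedSeries G P (n + 1) :=
  Subgroup.le_topologicalClosure _
    (Subgroup.mem_sup_right (Subgroup.subset_closure ⟨x, hx, rfl⟩))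

theorem antitone_gradedSeries (P : ℕ → ℕ) : Antitone (gradedSeries G P) := by
  refine antitone_nat_of_succ_le fun n => ?_
  refine Subgroup.topologicalClosure_minimal _ (sup_le ?_ ?_) (isClosed_gradedSeries P n)
  · rw [Subgroup.commutator_le]
    intro x hx y hy
    exact mul_mem (mul_mem (mul_mem hx hy) (inv_mem hx)) (inv_mem hy)
  · rw [Subgroup.closure_le]
    rintro _ ⟨h, hh, rfl⟩
    exact pow_mem hh _

/-- Compactness: a decreasing sequence of closed sets with intersection `{1}` eventually enters any
open neighbourhood of `1`. -/
theorem IsGraded.exists_gradedSeries_le [CompactSpace G] {P : ℕ → ℕ} (hG : IsGraded G P)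
    {N : Subgroup G} (hN : IsOpen (N : Set G)) : ∃ n, gradedSeries G P n ≤ N := by
  have h := exists_subset_nhds_of_isCompact' (V := fun n => (gradedSeries G P n : Set G))
    (directed_of_isDirected_le fun _ _ h => antitone_gradedSeries P h)
    (fun n => (isClosed_gradedSeries P n).isCompact) (isClosed_gradedSeries P) (U := N) (by
      intro x hx
      refine hN.mem_nhds ?_
      have hx' : x ∈ ⨅ n, gradedSeries G P n := by
        rw [← SetLike.mem_coe, Subgroup.coe_iInf]
        exact hx
      rw [IsGraded] at hG
      rw [hG, Subgroup.mem_bot] at hx'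
      rw [hx']
      exact one_mem N)
  exact h

theorem IsGraded.isElemAGroup_quotient [CompactSpace G] {P : ℕ → ℕ} (hP : ∀ i, (P i).Prime)
    (hinj : Function.Injective P) (hG : IsGraded G P) (N : Subgroup G) [N.Normal]
    (hN : IsOpen (N : Set G)) : IsElemAGroup (G ⧸ N) := by
  have : Finite (G ⧸ N) := Subgroup.quotient_finite_of_isOpen N hN
  obtain ⟨n, hn⟩ := hG.exists_gradedSeries_le hN
  refine IsElemAGroup.of_series hP hinj (fun l => (gradedSeries G P l).map (QuotientGroup.mk' N))
    ?_ (fun a b h => Subgroup.map_mono (antitone_gradedSeries P h)) (n := n) ?_ ?_ ?_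
  · exact Subgroup.map_top_of_surjective _ (QuotientGroup.mk'_surjective N)
  · rwa [Subgroup.map_eq_bot_iff, QuotientGroup.ker_mk']
  · intro l
    rw [← Subgroup.map_commutator]
    exact Subgroup.map_mono (commutator_gradedSeries_le P l)
  · rintro l _ ⟨x, hx, rfl⟩
    exact ⟨x ^ P l, pow_mem_gradedSeries P l hx, map_pow _ _ _⟩

/-- A dense subgroup meets every coset of an open subgroup, so `Γ` maps onto the quotient. -/
theorem rank_quotient_le_of_dense {Γ : Subgroup G} [Group.FG Γ] (hΓ : Dense (Γ : Set G))
    (N : Subgroup G) [N.Normal] (hN : IsOpen (N : Set G)) [Finite (G ⧸ N)] :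
    Group.rank (G ⧸ N) ≤ Group.rank Γ := by
  refine Group.rank_le_of_surjective ((QuotientGroup.mk' N).comp Γ.subtype) fun q => ?_
  obtain ⟨g, rfl⟩ := QuotientGroup.mk'_surjective N q
  obtain ⟨x, hx, hxΓ⟩ := hΓ.inter_open_nonempty ((fun y => g⁻¹ * y) ⁻¹' (N : Set G))
    (hN.preimage (continuous_const_mul g⁻¹)) ⟨g, by simp⟩
  exact ⟨⟨x, hxΓ⟩, (QuotientGroup.eq.2 hx).symm⟩

/-- Finiteness is not known beforehand. If the bound failed, one more subgroup than it allows could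
be chosen; their intersection is open and normal, so they all appear in one finite quotient and
contradict the finite bound. The `+ 1` on the rank keeps `d` nonzero. -/
theorem IsGraded.numOpenNormal_le [CompactSpace G] {P : ℕ → ℕ} (hP : ∀ i, (P i).Prime)
    (hinj : Function.Injective P) (hG : IsGraded G P) {Γ : Subgroup G} [Group.FG Γ]
    (hΓ : Dense (Γ : Set G)) {k : ℕ} (hk : 1 ≤ k) :
    numOpenNormal G k ≤ ((k ^ (9 * (Group.rank Γ + 1) + 2) : ℕ) : ℕ∞) := by
  by_contra! hlt
  rw [numOpenNormal] at hlt
  obtain ⟨t, hts, htc⟩ := Set.exists_subset_encard_eq (Order.add_one_le_of_lt hlt)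
  have htfin : t.Finite := by
    apply Set.finite_of_encard_eq_coe (k := k ^ (9 * (Group.rank Γ + 1) + 2) + 1)
    rw [htc]
    norm_cast
  let N₀ : Subgroup G := sInf t
  have hN₀n : N₀.Normal := by
    refine ⟨fun x hx g => ?_⟩
    rw [Subgroup.mem_sInf] at hx ⊢
    exact fun N hN => (hts hN).1.conj_mem x (hx N hN) g
  have hN₀o : IsOpen (N₀ : Set G) := by
    rw [Subgroup.coe_sInf]
    exact htfin.isOpen_biInter fun N hN => (hts hN).2.1
  have hX := hG.isElemAGroup_quotient hP hinj N₀ hN₀o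
  have := hX.finite
  have hrank := (rank_quotient_le_of_dense hΓ N₀ hN₀o).trans (Nat.le_succ _)
  have hsurj := QuotientGroup.mk'_surjective N₀
  have hcm : ∀ N ∈ t, (N.map (QuotientGroup.mk' N₀)).comap (QuotientGroup.mk' N₀) = N := by
    intro N hN
    rw [Subgroup.comap_map_eq, QuotientGroup.ker_mk', sup_eq_left]
    exact sInf_le hN
  have hle : t.ncard ≤ k ^ (9 * (Group.rank Γ + 1) + 2) := by
    refine le_trans ?_ (hX.ncard_normal_le hrank (Nat.succ_ne_zero _) hk)
    refine Set.ncard_le_ncard_of_injOn (fun N => N.map (QuotientGroup.mk' N₀)) ?_ ?_ (Set.toFinite _)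
    · intro N hN
      refine ⟨(hts hN).1.map _ hsurj, ?_⟩
      rw [← Subgroup.index_comap_of_surjective _ hsurj, hcm N hN]
      exact (hts hN).2.2
    · intro N hN N' hN' h
      rw [← hcm N hN, ← hcm N' hN']
      exact congrArg _ h
  rw [← htfin.cast_ncard_eq] at htc
  have : t.ncard = k ^ (9 * (Group.rank Γ + 1) + 2) + 1 := by exact_mod_cast htc
  omega

end GradedProfinite

theorem proposition4p3
    (P : ℕ → ℕ) (hP : ∀ i, (P i).Prime) (hdistinct : Function.Injective P)
    (G : Type*) [Group G] [TopologicalSpace G] [IsTopologicalGroup G]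
    [CompactSpace G] [T2Space G] [TotallyDisconnectedSpace G]
    (hfg : GradedProfinite.IsTopologicallyFG G)
    (hgraded : GradedProfinite.IsGraded G P) :
    GradedProfinite.HasPolynomialNormalSubgroupGrowth G := by
  obtain ⟨Γ, hΓ, hdense⟩ := hfg
  have : Group.FG Γ := (Group.fg_iff_subgroup_fg Γ).2 hΓ
  -- Summing `k` terms, each at most `k ^ (9 * (Group.rank Γ + 1) + 2)`, raises the exponent by one.
  refine ⟨1, 9 * (Group.rank Γ + 1) + 3, fun k hk => ?_⟩
  have h1 : ∀ l ∈ Finset.Icc 1 k, GradedProfinite.numOpenNormal G l ≤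
      ((k ^ (9 * (Group.rank Γ + 1) + 2) : ℕ) : ℕ∞) := by
    intro l hl
    rw [Finset.mem_Icc] at hl
    refine (hgraded.numOpenNormal_le hP hdistinct hdense hl.1).trans ?_
    exact_mod_cast Nat.pow_le_pow_left hl.2 _
  refine (Finset.sum_le_card_nsmul _ _ _ h1).trans ?_
  rw [Nat.card_Icc, Nat.add_sub_cancel, nsmul_eq_mul, ← Nat.cast_mul, one_mul, mul_comm,
    ← pow_succ]
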